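/- Let $G=(F\sqcup W,E)$ be a finite bipartite graph without multiple edges, and write $E_v$ for the set of edges at a vertex $v$ and $X_v:=X\cap E_v$ for $X\subseteq E$. Each worker $w\in W$ has a strict linear order $>_w$ on $E_w$; for $Z\subseteq E_w$ let $C_w(Z)$ consist of the $>_w$-best edge of $Z$ (and $C_w(\emptyset)=\emptyset$), i.e. workers have unit quotas. Each firm $f\in F$ has a choice function $C_f:2^{E_f}\to 2^{E_f}$ with $C_f(Z)\subseteq Z$ such that for all $Z'\subseteq Z\subseteq E_f$: $C_f(Z')=C_f(Z)$ if $C_f(Z)\subseteq Z'$; $C_f(Z)\cap Z'\subseteq C_f(Z')$; and $|C_f(Z')|\le|C_f(Z)|$. A set $X\subseteq E$ is a *stable matching* if $C_v(X_v)=X_v$ for all $v\in F\sqcup W$ and no edge $e=wf\in E\setminus X$ satisfies both $e\in C_w(X_w\cup\{e\})$ and $e\in C_f(X_f\cup\{e\})$. Let $\mathcal S$ be the set of stable matchings, ordered by $X\preceq Y$ iff $C_f(X_f\cup Y_f)=Y_f$ for all $f\in F$, and let $X_{\min},X_{\max}$ be its least and greatest elements. *Rotations.* Let $X\in\mathcal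 S$. For $w\in W$ with $X_w=\{x_w\}$, let $a_w$ be the $>_w$-best edge $e=wf\in E\setminus X$ with $x_w>_w e$ and $e\in C_f(X_f\cup\{e\})$, if such an edge exists. If $a_w=wf$ and $C_f(X_f\cup\{a_w\})=(X_f\setminus\{b\})\cup\{a_w\}$ with $b\in X_f$, call $(a_w,b)$ a tandem and $b$ the edge associated with $a_w$. Let $D$ be the directed graph of all edges $a_w$, directed from $W$ to $F$, and all edges associated with them, directed from $F$ to $W$. As long as there is a worker $w$ that $a_w$ leaves but no edge of the current graph enters, delete $a_w$, and also its associated edge if that edge is in no other tandem $(a_{w'},b)$ with $a_{w'}$ in the current graph. The final graph is the active graph of $X$. The rotations generated by $X$ are the edge-simple directed cycles $L$ of the active graph that pass each firm by tandems; $L^+$ and $L^-$ denote the sets of edges of $L$ directed from $W$ to $F$ and from $F$ to $W$, and $L$ is identified with $(L^+,L^-)$. Applying $L$ replaces $X$ by $(X\setminus L^-)\cup L^+$. A full route is a sequence of stable matchings from $X_{\min}$ to $X_{\max}$ in which each matching arises from the preceding one by applying a rotation generated by it. Let $\mathcal R$ be the set of rotations applied in full routes, and for $R,R'\in\mathcal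 R$ write $R\lessdot R'$ if $R$ is applied earlier than $R'$ in every full route. Let $\mathcal I$ be the set of ideals of $(\mathcal R,\lessdot)$: the sets $I\subseteq\mathcal R$ such that $R\lessdot R'\in I$ implies $R\in I$. For a finite set $T$ and $Y\subseteq T$, $\chi^Y\in\mathbb R^{T}$ is the characteristic vector of $Y$. Put $\operatorname{conv}(\mathcal S):=\operatorname{conv}\{\chi^X: X\in\mathcal S\}\subset\mathbb R^E$ and $\operatorname{conv}(\mathcal I):=\operatorname{conv}\{\chi^I: I\in\mathcal I\}\subset\mathbb R^{\mathcal R}$. Let $A\in\mathbb R^{E\times\mathcal R}$ be the matrix whose column $\beta^R$, $R\in\mathcal R$, is $1$ on $R^+$, $-1$ on $R^-$ and $0$ elsewhere. **Corollary 6.1.** The relation $\lessdot$ is a strict partial order on $\mathcal R$. The matrix $A$ has full column rank $|\mathcal R|$. Moreover, $$\dim\operatorname{conv}(\mathcal S)=\dim\operatorname{conv}(\mathcal I)=|\mathcal R|,$$ the polytope $\operatorname{conv}(\mathcal I)$ is the order polytope of $(\mathcal R,\lessdot)$, i.e. $$\operatorname{conv}(\mathcal I)=\{\lambda\in\mathbb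 R^{\mathcal R}:\ 0\le\lambda(R)\le1\ (R\in\mathcal R),\ \ \lambda(R)\ge\lambda(R')\ (R\lessdot R')\},$$ $X_{\min}$ exists, and the affine map $\lambda\mapsto\chi^{X_{\min}}+A\lambda$ is injective and maps $\operatorname{conv}(\mathcal I)$ onto $\operatorname{conv}(\mathcal S)$. In particular, $\operatorname{conv}(\mathcal S)$ is affinely congruent to the order polytope of $(\mathcal R,\lessdot)$. -/

import Mathlib

/-- A market of the combined boolean model with unit quotas on the workers' side:
a finite bipartite graph without multiple edges, with parts `F` (firms) and `W` (workers) and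
edge set `E`, a strict linear order on the edges at each worker, and, at each firm, a choice
function that is consistent, substitutable and cardinally monotone. -/
structure CombinedMarket (F W E : Type*) [DecidableEq E] where
  /-- the end of an edge in `W` -/
  worker : E → W
  /-- the end of an edge in `F` -/
  firm : E → F
  /-- there are no multiple edges -/
  no_multiple_edges : ∀ e e' : E, worker e = worker e' → firm e = firm e' → e = e'
  /-- `better w e e'` says that the worker `w` prefers `e` to `e'`; only its restriction to the
  edges at `w` matters -/
  better : W → E → E → Prop
  better_linear : ∀ w : W,
    IsStrictTotalOrder {e : E // worker e = w} (fun e e' => better w e.1 e'.1)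
  /-- the choice functions of the firms; only the values on sets of edges at `f` matter -/
  choice : F → Finset E → Finset E
  choice_subset : ∀ (f : F) (Z : Finset E), (∀ e ∈ Z, firm e = f) → choice f Z ⊆ Z
  /-- consistency -/
  choice_consistent : ∀ (f : F) (Z Z' : Finset E), (∀ e ∈ Z, firm e = f) →
    Z' ⊆ Z → choice f Z ⊆ Z' → choice f Z' = choice f Z
  /-- substitutability -/
  choice_substitutable : ∀ (f : F) (Z Z' : Finset E), (∀ e ∈ Z, firm e = f) →
    Z' ⊆ Z → choice f Z ∩ Z' ⊆ choice f Z'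
  /-- cardinal monotonicity -/
  choice_card_mono : ∀ (f : F) (Z Z' : Finset E), (∀ e ∈ Z, firm e = f) →
    Z' ⊆ Z → (choice f Z').card ≤ (choice f Z).card

/-- A rotation, as a subgraph: its set `plus` of edges directed from `W` to `F` and its set `minus`
of edges directed from `F` to `W`. -/
@[ext] structure SignedCycle (E : Type*) where
  plus : Finset E
  minus : Finset E

instance SignedCycle.instFinite {E : Type*} [Finite E] : Finite (SignedCycle E) :=
  Finite.of_injective (fun L : SignedCycle E => (L.plus, L.minus)) (by
    intro L L' h
    have h1 := congrArg Prod.fst h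
    have h2 := congrArg Prod.snd h
    exact SignedCycle.ext h1 h2)

/-- A directed graph on the vertex set `F ⊔ W`: the edges in `toFirm` are directed from their
worker to their firm, and those in `toWorker` from their firm to their worker. -/
structure BipartiteDigraph (E : Type*) where
  toFirm : Finset E
  toWorker : Finset E

/-- The characteristic vector of a set of edges. -/
def edgeVector {E : Type*} [DecidableEq E] (X : Finset E) : E → ℝ :=
  fun e => if e ∈ X then 1 else 0

namespace CombinedMarket

open scoped Classical in
/-- The restriction `X_f` of `X` to the edges at the firm `f`. -/
noncomputable def atFirm {F W E : Type*} [DecidableEq E] (M : CombinedMarket F W E)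
    (X : Finset E) (f : F) : Finset E :=
  X.filter (fun e => M.firm e = f)

open scoped Classical in
/-- The restriction `X_w` of `X` to the edges at the worker `w`. -/
noncomputable def atWorker {F W E : Type*} [DecidableEq E] (M : CombinedMarket F W E)
    (X : Finset E) (w : W) : Finset E :=
  X.filter (fun e => M.worker e = w)

open scoped Classical in
/-- The choice function of a worker (of quota one): the most preferred edge of a set of edges
at `w`, if the set is nonempty. -/
noncomputable def workerChoice {F W E : Type*} [DecidableEq E] (M : CombinedMarket F W E)
    (w : W) (Z : Finset E) : Finset E :=
  Z.filter (fun e => ∀ e' ∈ Z, e' ≠ e → M.better w e e')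

/-- `X` is acceptable for all agents. -/
def Acceptable {F W E : Type*} [DecidableEq E] (M : CombinedMarket F W E) (X : Finset E) : Prop :=
  (∀ f, M.choice f (M.atFirm X f) = M.atFirm X f) ∧
    ∀ w, M.workerChoice w (M.atWorker X w) = M.atWorker X w

/-- The edge `e` is interesting under `X` for its firm. -/
def FirmInterested {F W E : Type*} [DecidableEq E] (M : CombinedMarket F W E)
    (X : Finset E) (e : E) : Prop :=
  e ∉ X ∧ e ∈ M.choice (M.firm e) (insert e (M.atFirm X (M.firm e)))

/-- The edge `e` is interesting under `X` for its worker. -/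
def WorkerInterested {F W E : Type*} [DecidableEq E] (M : CombinedMarket F W E)
    (X : Finset E) (e : E) : Prop :=
  e ∉ X ∧ e ∈ M.workerChoice (M.worker e) (insert e (M.atWorker X (M.worker e)))

/-- `X` is a stable matching: it is acceptable and no edge blocks it. -/
def Stable {F W E : Type*} [DecidableEq E] (M : CombinedMarket F W E) (X : Finset E) : Prop :=
  M.Acceptable X ∧ ∀ e, ¬ (M.FirmInterested X e ∧ M.WorkerInterested X e)

/-- `X ≼_F Y`: each firm weakly prefers (its part of) `Y` to `X`. -/
def FirmLE {F W E : Type*} [DecidableEq E] (M : CombinedMarket F W E) (X Y : Finset E) : Prop :=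
  ∀ f, M.choice f (M.atFirm Y f ∪ M.atFirm X f) = M.atFirm Y f

/-- `X` is the minimal stable matching with respect to the firms. -/
def IsXmin {F W E : Type*} [DecidableEq E] (M : CombinedMarket F W E) (X : Finset E) : Prop :=
  M.Stable X ∧ ∀ Y, M.Stable Y → M.FirmLE X Y

/-- `X` is the maximal stable matching with respect to the firms. -/
def IsXmax {F W E : Type*} [DecidableEq E] (M : CombinedMarket F W E) (X : Finset E) : Prop :=
  M.Stable X ∧ ∀ Y, M.Stable Y → M.FirmLE Y X

/-- The edges `e` at a fully filled worker `w` such that `w` prefers its matching edge `x_w` to `e`,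
and `e` is interesting for its firm. -/
def WCandidate {F W E : Type*} [DecidableEq E] (M : CombinedMarket F W E)
    (X : Finset E) (e : E) : Prop :=
  (∃ x, M.atWorker X (M.worker e) = {x} ∧ M.better (M.worker e) x e) ∧ M.FirmInterested X e

/-- `a` is the `W`-admissible edge `a_w` for `X`, where `w` is the worker of `a`. -/
def WAdmissible {F W E : Type*} [DecidableEq E] (M : CombinedMarket F W E)
    (X : Finset E) (a : E) : Prop :=
  M.WCandidate X a ∧
    ∀ e, M.WCandidate X e → M.worker e = M.worker a → e ≠ a → M.better (M.worker a) a e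

/-- `(a, b)` is a tandem for `X` passing the firm of `a`; `b` is the `F`-admissible edge associated
with the `W`-admissible edge `a`. -/
def Tandem {F W E : Type*} [DecidableEq E] (M : CombinedMarket F W E)
    (X : Finset E) (a b : E) : Prop :=
  M.WAdmissible X a ∧ b ∈ M.atFirm X (M.firm a) ∧
    M.choice (M.firm a) (insert a (M.atFirm X (M.firm a))) =
      insert a ((M.atFirm X (M.firm a)).erase b)

open scoped Classical in
/-- The directed graph `D(X)` of the `W`- and `F`-admissible edges. -/
noncomputable def admissibleGraph {F W E : Type*} [DecidableEq E] [Fintype E]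
    (M : CombinedMarket F W E) (X : Finset E) : BipartiteDigraph E where
  toFirm := Finset.univ.filter (fun a => M.WAdmissible X a)
  toWorker := Finset.univ.filter (fun b => ∃ a, M.Tandem X a b)

open scoped Classical in
/-- The deletion of the `W`-admissible edge `a` from `D`, together with its associated edge `b` if
there is one and `b` does not occur in another tandem in `D`. -/
noncomputable def deleteArc {F W E : Type*} [DecidableEq E]
    (M : CombinedMarket F W E) (X : Finset E) (D : BipartiteDigraph E) (a : E) :
    BipartiteDigraph E where
  toFirm := D.toFirm.erase a
  toWorker := D.toWorker.filter
    (fun b => ¬ (M.Tandem X a b ∧ ∀ a' ∈ D.toFirm, M.Tandem X a' b → a' = a))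

/-- In the current graph `D`, the edge `a` leaves a worker that no edge of `D` enters. -/
def Deletable {F W E : Type*} [DecidableEq E] (M : CombinedMarket F W E)
    (D : BipartiteDigraph E) (a : E) : Prop :=
  a ∈ D.toFirm ∧ ∀ b ∈ D.toWorker, M.worker b ≠ M.worker a

/-- One step of the cleaning procedure (isolated vertices play no role and are not recorded). -/
def CleaningStep {F W E : Type*} [DecidableEq E] (M : CombinedMarket F W E)
    (X : Finset E) (D D' : BipartiteDigraph E) : Prop :=
  ∃ a, M.Deletable D a ∧ D' = M.deleteArc X D a

/-- `Γ` is the active graph for `X`: it results from `D(X)` by applying steps of the cleaning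
procedure until none is possible. -/
def IsActiveGraph {F W E : Type*} [DecidableEq E] [Fintype E] (M : CombinedMarket F W E)
    (X : Finset E) (Γ : BipartiteDigraph E) : Prop :=
  Relation.ReflTransGen (M.CleaningStep X) (M.admissibleGraph X) Γ ∧
    ∀ a, ¬ M.Deletable Γ a

/-- `L` is a rotation generated by `X`: an edge-simple directed cycle
`a 0, b 0, a 1, b 1, …, a n, b n` of the active graph for `X`, passing each firm by a tandem
`(a i, b i)`, while `b i` enters and `a (i + 1)` leaves the same worker (indices are cyclic). -/
def IsRotation {F W E : Type*} [DecidableEq E] [Fintype E] (M : CombinedMarket F W E)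
    (X : Finset E) (L : SignedCycle E) : Prop :=
  ∃ Γ, M.IsActiveGraph X Γ ∧
    ∃ (n : ℕ) (a b : Fin (n + 1) → E),
      Function.Injective a ∧ Function.Injective b ∧
      (∀ i, a i ∈ Γ.toFirm ∧ b i ∈ Γ.toWorker ∧ M.Tandem X (a i) (b i) ∧
        M.worker (b i) = M.worker (a (i + 1))) ∧
      L.plus = Finset.univ.image a ∧ L.minus = Finset.univ.image b

/-- `M.Route X l Y`: there is a route from the stable matching `X` to `Y` along which the rotations
in the list `l` are applied, in this order. -/
inductive Route {F W E : Type*} [DecidableEq E] [Fintype E] (M : CombinedMarket F W E) :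
    Finset E → List (SignedCycle E) → Finset E → Prop
  | nil (X : Finset E) : M.Stable X → Route M X [] X
  | cons (X Y : Finset E) (L : SignedCycle E) (l : List (SignedCycle E)) :
      M.Stable X → M.IsRotation X L → Route M ((X \ L.minus) ∪ L.plus) l Y → Route M X (L :: l) Y

/-- `l` is the list of the rotations applied along a full route, in the order of application. -/
def FullRoute {F W E : Type*} [DecidableEq E] [Fintype E] (M : CombinedMarket F W E)
    (l : List (SignedCycle E)) : Prop :=
  ∃ Xmin Xmax, M.IsXmin Xmin ∧ M.IsXmax Xmax ∧ M.Route Xmin l Xmax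

/-- The set `ℛ` of rotations applied along full routes. -/
abbrev Rotation {F W E : Type*} [DecidableEq E] [Fintype E] (M : CombinedMarket F W E) : Type _ :=
  {R : SignedCycle E // ∃ l, M.FullRoute l ∧ R ∈ l}

noncomputable instance instFintypeRotation {F W E : Type*} [DecidableEq E] [Fintype E]
    (M : CombinedMarket F W E) : Fintype M.Rotation :=
  Fintype.ofFinite _

/-- `R ⋖ R'`: in every full route, `R` is applied earlier than `R'`. -/
def Precedes {F W E : Type*} [DecidableEq E] [Fintype E] (M : CombinedMarket F W E)
    (R R' : M.Rotation) : Prop :=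
  ∀ l, M.FullRoute l → List.Sublist [R.1, R'.1] l

/-- The ideals of the rotational poset. -/
def IsRotationIdeal {F W E : Type*} [DecidableEq E] [Fintype E] (M : CombinedMarket F W E)
    (I : Set M.Rotation) : Prop :=
  ∀ R R', M.Precedes R R' → R' ∈ I → R ∈ I

/-- The matrix `A` with rows indexed by the edges and columns `β^R` indexed by the rotations. -/
def rotationMatrix {F W E : Type*} [DecidableEq E] [Fintype E] (M : CombinedMarket F W E) :
    Matrix E M.Rotation ℝ :=
  Matrix.of (fun e R => if e ∈ R.1.plus then 1 else if e ∈ R.1.minus then -1 else 0)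

/-- The affine map `λ ↦ χ^X + A λ`. -/
noncomputable def gamma {F W E : Type*} [DecidableEq E] [Fintype E] (M : CombinedMarket F W E)
    (X : Finset E) : (M.Rotation → ℝ) →ᵃ[ℝ] (E → ℝ) :=
  AffineMap.const ℝ (M.Rotation → ℝ) (edgeVector X) + M.rotationMatrix.mulVecLin.toAffineMap

/-- The polytope `conv(𝒮)` of stable matchings. -/
def matchingPolytope {F W E : Type*} [DecidableEq E] (M : CombinedMarket F W E) : Set (E → ℝ) :=
  convexHull ℝ {x | ∃ X, M.Stable X ∧ x = edgeVector X}

/-- The polytope `conv(ℐ)` of ideals of the rotational poset. -/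
noncomputable def idealPolytope {F W E : Type*} [DecidableEq E] [Fintype E]
    (M : CombinedMarket F W E) : Set (M.Rotation → ℝ) :=
  convexHull ℝ {u | ∃ I : Set M.Rotation, M.IsRotationIdeal I ∧ u = I.indicator 1}

/-- The order polytope of the rotational poset, given by its linear inequalities. -/
def orderPolytope {F W E : Type*} [DecidableEq E] [Fintype E] (M : CombinedMarket F W E) :
    Set (M.Rotation → ℝ) :=
  {u | (∀ R, 0 ≤ u R ∧ u R ≤ 1) ∧ ∀ R R', M.Precedes R R' → u R' ≤ u R}

end CombinedMarket

/-- The dimension of a nonempty set in a real vector space: that of its affine hull. -/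
noncomputable def affineDim {V : Type*} [AddCommGroup V] [Module ℝ V] (P : Set V) : ℕ :=
  Module.finrank ℝ (affineSpan ℝ P).direction

/-! On stable matchings the firms' order is opposite to the workers' interests (`firmLE_iff_le`), so
going up a route moves workers to worse edges, and an edge once left is never regained. Comparable
stable matchings have equal size (`Le.card_eq`); with cardinal monotonicity this often turns partial
knowledge of a choice into an equality by counting.

A stable matching strictly below `Y` generates a rotation that does not lead beyond `Y`
(`Le.exists_isRotation`), and distinct rotations generated by one matching commute
(`IsRotation.isRotation_apply`). By a diamond argument, routes with the same ends apply the same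
rotations (`Route.perm`), so a full route lists ℛ without repetition. The rotations on a route from
the least matching form an ideal. Conversely, every ideal arises in this way
(`IsRotationIdeal.exists_route`): in a full route its members are pulled in front of the other
rotations, which `IsRotation.of_apply` makes possible.

Hence `gamma` carries the indicators of ideals onto the vectors of stable matchings. It is injective
since the rotation vectors are triangular along a route (`Route.eq_zero_of_sum_eq_zero`). The
inequalities of the order polytope follow by averaging over superlevel sets, and its dimension from
adding one element to an ideal. -/

namespace CombinedMarket

/-! ### Preferences, the simultaneous choice of the firms, and stability -/

variable {F W E : Type*} [DecidableEq E] (M : CombinedMarket F W E)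

/-- The edge `e` is preferred to `e'` by their common worker. -/
def Pref (e e' : E) : Prop := M.worker e = M.worker e' ∧ M.better (M.worker e) e e'

theorem pref_irrefl (e : E) : ¬ M.Pref e e := fun h =>
  have := M.better_linear (M.worker e)
  irrefl_of (fun e₁ e₂ : {e' : E // M.worker e' = M.worker e} => M.better (M.worker e) e₁.1 e₂.1)
    ⟨e, rfl⟩ h.2

theorem Pref.trans {M : CombinedMarket F W E} {e₁ e₂ e₃ : E} (h : M.Pref e₁ e₂)
    (h' : M.Pref e₂ e₃) : M.Pref e₁ e₃ := by
  have := M.better_linear (M.worker e₁)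
  refine ⟨h.1.trans h'.1, ?_⟩
  exact trans_of (fun a b : {e' : E // M.worker e' = M.worker e₁} =>
    M.better (M.worker e₁) a.1 b.1) (a := ⟨e₁, rfl⟩) (b := ⟨e₂, h.1.symm⟩)
    (c := ⟨e₃, (h.1.trans h'.1).symm⟩) h.2 (by simpa only [h.1] using h'.2)

theorem pref_or_pref {e e' : E} (h : M.worker e = M.worker e') (hne : e ≠ e') :
    M.Pref e e' ∨ M.Pref e' e := by
  have := M.better_linear (M.worker e)
  rcases trichotomous_of (fun a b : {x : E // M.worker x = M.worker e} =>
    M.better (M.worker e) a.1 b.1) ⟨e, rfl⟩ ⟨e', h.symm⟩ with h1 | h1 | h1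
  · exact Or.inl ⟨h, h1⟩
  · exact absurd (congrArg Subtype.val h1) hne
  · exact Or.inr ⟨h.symm, by simpa only [h] using h1⟩

theorem pref_wellFounded [Finite E] : WellFounded M.Pref :=
  have : IsTrans E M.Pref := ⟨fun _ _ _ h h' => h.trans h'⟩
  have : Std.Irrefl M.Pref := ⟨M.pref_irrefl⟩
  Finite.wellFounded_of_trans_of_irrefl M.Pref

open scoped Classical in
/-- The simultaneous choice of all firms. -/
noncomputable def ch (Z : Finset E) : Finset E :=
  Z.filter (fun e => e ∈ M.choice (M.firm e) (M.atFirm Z (M.firm e)))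

theorem mem_atFirm {Z : Finset E} {f : F} {e : E} :
    e ∈ M.atFirm Z f ↔ e ∈ Z ∧ M.firm e = f := by
  simp [atFirm]

theorem mem_atWorker {Z : Finset E} {w : W} {e : E} :
    e ∈ M.atWorker Z w ↔ e ∈ Z ∧ M.worker e = w := by
  simp [atWorker]

theorem firm_of_mem_atFirm {Z : Finset E} {f : F} : ∀ e ∈ M.atFirm Z f, M.firm e = f :=
  fun _ h => (M.mem_atFirm.1 h).2

theorem choice_atFirm_subset (Z : Finset E) (f : F) :
    M.choice f (M.atFirm Z f) ⊆ M.atFirm Z f :=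
  M.choice_subset f _ M.firm_of_mem_atFirm

theorem mem_ch {Z : Finset E} {e : E} :
    e ∈ M.ch Z ↔ e ∈ M.choice (M.firm e) (M.atFirm Z (M.firm e)) := by
  simp only [ch, Finset.mem_filter, and_iff_right_iff_imp]
  exact fun h => (M.mem_atFirm.1 (M.choice_atFirm_subset Z _ h)).1

theorem atFirm_ch (Z : Finset E) (f : F) : M.atFirm (M.ch Z) f = M.choice f (M.atFirm Z f) := by
  ext e
  rw [mem_atFirm, mem_ch]
  constructor
  · rintro ⟨h, rfl⟩
    exact h
  · intro h
    obtain rfl := (M.mem_atFirm.1 (M.choice_atFirm_subset Z _ h)).2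
    exact ⟨h, rfl⟩

theorem atFirm_injective {Z Z' : Finset E} (h : ∀ f, M.atFirm Z f = M.atFirm Z' f) : Z = Z' := by
  ext e
  have := congrArg (e ∈ ·) (h (M.firm e))
  simpa [mem_atFirm] using this

theorem atFirm_mono {Z Z' : Finset E} (h : Z' ⊆ Z) (f : F) : M.atFirm Z' f ⊆ M.atFirm Z f := by
  intro e he
  rw [mem_atFirm] at he ⊢
  exact ⟨h he.1, he.2⟩

theorem ch_subset (Z : Finset E) : M.ch Z ⊆ Z := Finset.filter_subset _ _

theorem ch_consistent {Z Z' : Finset E} (h : Z' ⊆ Z) (h' : M.ch Z ⊆ Z') : M.ch Z' = M.ch Z := by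
  apply M.atFirm_injective
  intro f
  rw [atFirm_ch, atFirm_ch]
  apply M.choice_consistent f _ _ M.firm_of_mem_atFirm (M.atFirm_mono h f)
  rw [← atFirm_ch]
  exact M.atFirm_mono h' f

theorem mem_ch_of_subset {Z Z' : Finset E} (h : Z' ⊆ Z) {e : E} (he : e ∈ M.ch Z)
    (he' : e ∈ Z') : e ∈ M.ch Z' := by
  rw [mem_ch] at he ⊢
  exact M.choice_substitutable _ _ _ M.firm_of_mem_atFirm (M.atFirm_mono h _)
    (Finset.mem_inter.2 ⟨he, M.mem_atFirm.2 ⟨he', rfl⟩⟩)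

theorem card_ch_le {Z Z' : Finset E} (h : Z' ⊆ Z) : (M.ch Z').card ≤ (M.ch Z).card := by
  classical
  have key : ∀ Y ⊆ Z, (M.ch Y).card =
      ∑ f ∈ Z.image M.firm, (M.choice f (M.atFirm Y f)).card := by
    intro Y hY
    rw [Finset.card_eq_sum_card_fiberwise (f := M.firm) (t := Z.image M.firm)]
    · refine Finset.sum_congr rfl fun f _ => ?_
      rw [← atFirm_ch, atFirm]
    · intro e he
      exact Finset.mem_image_of_mem _ (hY (M.ch_subset Y he))
  rw [key Z' h, key Z subset_rfl]
  exact Finset.sum_le_sum fun f _ =>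
    M.choice_card_mono f _ _ M.firm_of_mem_atFirm (M.atFirm_mono h f)

theorem ch_insert_of_notMem {X : Finset E} {e : E} (h : e ∉ M.ch (insert e X)) :
    M.ch (insert e X) = M.ch X :=
  (M.ch_consistent (Finset.subset_insert e X)
    ((Finset.subset_insert_iff_of_notMem h).1 (M.ch_subset _))).symm

theorem atFirm_insert_self (X : Finset E) (e : E) :
    M.atFirm (insert e X) (M.firm e) = insert e (M.atFirm X (M.firm e)) := by
  ext x
  simp only [mem_atFirm, Finset.mem_insert]
  constructor
  · rintro ⟨rfl | h, h'⟩
    · exact Or.inl rfl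
    · exact Or.inr ⟨h, h'⟩
  · rintro (rfl | ⟨h, h'⟩)
    · exact ⟨Or.inl rfl, rfl⟩
    · exact ⟨Or.inr h, h'⟩

theorem atFirm_insert_of_ne (X : Finset E) {e : E} {f : F} (h : M.firm e ≠ f) :
    M.atFirm (insert e X) f = M.atFirm X f := by
  ext x
  simp only [mem_atFirm, Finset.mem_insert]
  constructor
  · rintro ⟨rfl | h1, h'⟩
    · exact absurd h' h
    · exact ⟨h1, h'⟩
  · rintro ⟨h1, h'⟩
    exact ⟨Or.inr h1, h'⟩

theorem firmInterested_iff {X : Finset E} {e : E} :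
    M.FirmInterested X e ↔ e ∉ X ∧ e ∈ M.ch (insert e X) := by
  rw [FirmInterested, mem_ch, atFirm_insert_self]

theorem mem_ch_insert_of_firm_ne {X : Finset E} {e b : E} (h : M.firm e ≠ M.firm b)
    (hb : b ∈ M.ch X) : b ∈ M.ch (insert e X) := by
  rw [mem_ch] at hb ⊢
  rwa [M.atFirm_insert_of_ne X h]

/-- Some edge of `X` at the worker of `e` is preferred to `e`. -/
def Below (X : Finset E) (e : E) : Prop := ∃ x ∈ X, M.Pref x e

/-- Every worker has at most one edge in `X`. -/
def Unit (X : Finset E) : Prop := ∀ x ∈ X, ∀ y ∈ X, M.worker x = M.worker y → x = y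

variable {M}

theorem Unit.notMem_of_below {X : Finset E} (hX : M.Unit X) {e : E} (h : M.Below X e) :
    e ∉ X := by
  rintro he
  obtain ⟨x, hx, hp⟩ := h
  obtain rfl := hX x hx e he hp.1
  exact M.pref_irrefl _ hp

theorem Below.trans {X : Finset E} {e e' : E} (h : M.Below X e) (h' : M.Pref e e') :
    M.Below X e' :=
  let ⟨x, hx, hp⟩ := h
  ⟨x, hx, hp.trans h'⟩

variable (M)

theorem unit_iff {X : Finset E} :
    M.Unit X ↔ ∀ w, M.workerChoice w (M.atWorker X w) = M.atWorker X w := by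
  simp only [workerChoice, Finset.filter_eq_self, mem_atWorker]
  constructor
  · rintro h w e ⟨he, rfl⟩ e' ⟨he', hw⟩ hne
    exact absurd (h e' he' e he hw) hne
  · intro h x hx y hy hw
    by_contra hne
    have h1 : M.Pref x y := ⟨hw, h _ x ⟨hx, rfl⟩ y ⟨hy, hw.symm⟩ (Ne.symm hne)⟩
    have h2 : M.Pref y x := ⟨hw.symm, h _ y ⟨hy, rfl⟩ x ⟨hx, hw⟩ hne⟩
    exact M.pref_irrefl _ (h1.trans h2)

theorem workerInterested_iff {X : Finset E} {e : E} :
    M.WorkerInterested X e ↔ e ∉ X ∧ ¬ M.Below X e := by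
  simp only [WorkerInterested, workerChoice, Finset.mem_filter, Finset.mem_insert, mem_atWorker,
    true_or, true_and, Below, not_exists, not_and]
  refine and_congr_right fun he => ⟨fun h x hx hp => ?_, ?_⟩
  · have hne : x ≠ e := fun h => he (h ▸ hx)
    have : M.Pref e x := ⟨hp.1.symm, h x (Or.inr ⟨hx, hp.1⟩) hne⟩
    exact M.pref_irrefl _ (this.trans hp)
  · rintro h e' (rfl | ⟨h', hw⟩) hne
    · exact absurd rfl hne
    · exact ((M.pref_or_pref hw hne).resolve_left (h e' h')).2

theorem acceptable_iff {X : Finset E} : M.Acceptable X ↔ M.ch X = X ∧ M.Unit X := by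
  rw [Acceptable, unit_iff]
  refine and_congr_left fun _ => ⟨fun h => M.atFirm_injective fun f => ?_, fun h f => ?_⟩
  · rw [atFirm_ch, h]
  · rw [← atFirm_ch, h]

theorem stable_iff {X : Finset E} : M.Stable X ↔ M.ch X = X ∧ M.Unit X ∧
    ∀ e, e ∉ X → e ∈ M.ch (insert e X) → M.Below X e := by
  rw [Stable, acceptable_iff, and_assoc]
  refine and_congr_right fun _ => and_congr_right fun _ => forall_congr' fun e => ?_
  rw [firmInterested_iff, workerInterested_iff]
  tauto

variable {M}

theorem Stable.ch_eq {X : Finset E} (h : M.Stable X) : M.ch X = X := (M.stable_iff.1 h).1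

theorem Stable.unit {X : Finset E} (h : M.Stable X) : M.Unit X := (M.stable_iff.1 h).2.1

theorem Stable.below {X : Finset E} (h : M.Stable X) {e : E} (he : e ∉ X)
    (he' : e ∈ M.ch (insert e X)) : M.Below X e := (M.stable_iff.1 h).2.2 e he he'

variable (M)

theorem wCandidate_iff {X : Finset E} (hX : M.Unit X) {e : E} :
    M.WCandidate X e ↔ M.Below X e ∧ e ∈ M.ch (insert e X) := by
  rw [WCandidate, firmInterested_iff]
  constructor
  · rintro ⟨⟨x, hx, hb⟩, -, h⟩
    have := M.mem_atWorker.1 (hx ▸ Finset.mem_singleton_self x)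
    exact ⟨⟨x, this.1, this.2, this.2 ▸ hb⟩, h⟩
  · rintro ⟨hB, h⟩
    refine ⟨?_, hX.notMem_of_below hB, h⟩
    obtain ⟨x, hx, hp⟩ := hB
    refine ⟨x, ?_, hp.1 ▸ hp.2⟩
    ext y
    rw [mem_atWorker, Finset.mem_singleton]
    constructor
    · rintro ⟨hy, hw⟩
      exact hX y hy x hx (hw.trans hp.1.symm)
    · rintro rfl
      exact ⟨hx, hp.1⟩

theorem wAdmissible_iff {X : Finset E} (hX : M.Unit X) {a : E} :
    M.WAdmissible X a ↔ (M.Below X a ∧ a ∈ M.ch (insert a X)) ∧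
      ∀ e, M.Below X e → e ∈ M.ch (insert e X) → M.worker e = M.worker a → e ≠ a →
        M.Pref a e := by
  simp only [WAdmissible, M.wCandidate_iff hX]
  refine and_congr_right fun _ => forall_congr' fun e => ?_
  constructor
  · intro h h1 h2 hw hne
    exact ⟨hw.symm, h ⟨h1, h2⟩ hw hne⟩
  · intro h h1 hw hne
    exact (h h1.1 h1.2 hw hne).2

/-- An offer to one firm leaves the choices of the other firms unchanged, so the local condition can
be expressed by `ch`. -/
theorem tandem_iff {X : Finset E} (hX : M.ch X = X) {a b : E} :
    M.Tandem X a b ↔ M.WAdmissible X a ∧ b ∈ X ∧ M.ch (insert a X) = insert a (X.erase b) := by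
  rw [Tandem]
  refine and_congr_right fun hA => ?_
  have ha : a ∉ X := hA.1.2.1
  rw [mem_atFirm, ← M.atFirm_insert_self, ← M.atFirm_ch]
  have key : M.firm b = M.firm a → insert a ((M.atFirm X (M.firm a)).erase b) =
      M.atFirm (insert a (X.erase b)) (M.firm a) := by
    intro hf
    rw [M.atFirm_insert_self]
    congr 1
    ext x
    simp only [Finset.mem_erase, mem_atFirm]
    tauto
  constructor
  · rintro ⟨⟨hb, hf⟩, h⟩
    refine ⟨hb, M.atFirm_injective fun f => ?_⟩
    by_cases hfa : M.firm a = f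
    · subst hfa
      rw [h, key hf]
    · rw [M.atFirm_ch, M.atFirm_insert_of_ne _ hfa, M.atFirm_insert_of_ne _ hfa, ← M.atFirm_ch, hX]
      ext x
      simp only [Finset.mem_erase, mem_atFirm]
      constructor
      · rintro ⟨h1, rfl⟩
        exact ⟨⟨fun h2 => hfa (h2 ▸ hf.symm), h1⟩, rfl⟩
      · rintro ⟨⟨-, h1⟩, h2⟩
        exact ⟨h1, h2⟩
  · rintro ⟨hb, h⟩
    have hf : M.firm b = M.firm a := by
      by_contra hf
      have h1 := M.mem_ch_insert_of_firm_ne (Ne.symm hf) (hX.symm ▸ hb)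
      rw [h, Finset.mem_insert] at h1
      rcases h1 with rfl | h1
      · exact ha hb
      · exact absurd rfl (Finset.mem_erase.1 h1).1
    exact ⟨⟨hb, hf⟩, by rw [h, key hf]⟩

/-! ### The order of stable matchings -/

/-- `Le X Y`: each worker with an edge in `Y` has an edge in `X` that is at least as good. -/
def Le (X Y : Finset E) : Prop := ∀ y ∈ Y, y ∈ X ∨ M.Below X y

variable {M}

theorem Le.refl (X : Finset E) : M.Le X X := fun _ h => Or.inl h

theorem Le.below {X Y : Finset E} (h : M.Le X Y) {e : E} (he : M.Below Y e) : M.Below X e := by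
  obtain ⟨y, hy, hp⟩ := he
  rcases h y hy with h | h
  · exact ⟨y, h, hp⟩
  · exact h.trans hp

theorem Le.trans {X Y Z : Finset E} (h : M.Le X Y) (h' : M.Le Y Z) : M.Le X Z := by
  intro z hz
  rcases h' z hz with h1 | h1
  · exact h z h1
  · exact Or.inr (h.below h1)

/-- An edge of `X` outside `Y` chosen from the union would be interesting for its firm under `Y`.
Stability puts it below `Y`, hence below `X`, to which it belongs. So only edges of `Y` are chosen,
and consistency concludes. -/
theorem Le.ch_union {X Y : Finset E} (h : M.Le X Y) (hX : M.Stable X) (hY : M.Stable Y) :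
    M.ch (Y ∪ X) = Y := by
  have h1 : M.ch (Y ∪ X) ⊆ Y := by
    intro e he
    by_contra heY
    have heX : e ∈ X := (Finset.mem_union.1 (M.ch_subset _ he)).resolve_left heY
    have h2 : e ∈ M.ch (insert e Y) := M.mem_ch_of_subset
      (Finset.insert_subset (Finset.mem_union_right _ heX) Finset.subset_union_left) he
      (Finset.mem_insert_self _ _)
    exact hX.unit.notMem_of_below (h.below (hY.below heY h2)) heX
  rw [← M.ch_consistent Finset.subset_union_left h1, hY.ch_eq]

theorem firmLE_iff_ch {X Y : Finset E} : M.FirmLE X Y ↔ M.ch (Y ∪ X) = Y := by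
  have key : ∀ f, M.atFirm Y f ∪ M.atFirm X f = M.atFirm (Y ∪ X) f := by
    intro f
    ext e
    simp only [Finset.mem_union, mem_atFirm]
    tauto
  simp only [FirmLE, key, ← M.atFirm_ch]
  exact ⟨fun h => M.atFirm_injective h, fun h f => by rw [h]⟩

/-- An edge of `Y` outside `X` that is chosen from the union is interesting for its firm under `X`,
so by stability its worker prefers the edge held in `X`. -/
theorem firmLE_iff_le {X Y : Finset E} (hX : M.Stable X) (hY : M.Stable Y) :
    M.FirmLE X Y ↔ M.Le X Y := by
  rw [firmLE_iff_ch]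
  refine ⟨fun h y hy => ?_, fun h => h.ch_union hX hY⟩
  refine or_iff_not_imp_left.2 fun hyX => hX.below hyX ?_
  exact M.mem_ch_of_subset (Finset.insert_subset (Finset.mem_union_left _ hy)
    Finset.subset_union_right) (h.symm ▸ hy) (Finset.mem_insert_self _ _)

/-- Path independence: alternatives rejected in favour of `Y` stay irrelevant. -/
theorem ch_insert_union {X Y : Finset E} (h : M.ch (Y ∪ X) = Y) (e : E) :
    M.ch (insert e (Y ∪ X)) = M.ch (insert e Y) := by
  refine (M.ch_consistent (Finset.insert_subset_insert _ Finset.subset_union_left) ?_).symm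
  intro u hu
  rw [Finset.mem_insert]
  refine or_iff_not_imp_left.2 fun hue => ?_
  rw [← h]
  exact M.mem_ch_of_subset (Finset.subset_insert _ _) hu
    ((Finset.mem_insert.1 (M.ch_subset _ hu)).resolve_left hue)

/-- Adding the rejected alternatives `X` to `Y` does not affect the choice (`ch_insert_union`);
substitutability then passes from the union to `insert e X`. -/
theorem Le.mem_ch_insert {X Y : Finset E} (h : M.Le X Y) (hX : M.Stable X) (hY : M.Stable Y)
    {e x : E} (hx : x ∈ M.ch (insert e Y)) (hx' : x ∈ insert e X) : x ∈ M.ch (insert e X) := by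
  rw [← ch_insert_union (h.ch_union hX hY)] at hx
  exact M.mem_ch_of_subset (Finset.insert_subset_insert _ Finset.subset_union_right) hx hx'

theorem Le.card_ch_insert_le {X Y : Finset E} (h : M.Le X Y) (hX : M.Stable X) (hY : M.Stable Y)
    (e : E) : (M.ch (insert e X)).card ≤ (M.ch (insert e Y)).card := by
  rw [← ch_insert_union (h.ch_union hX hY)]
  exact M.card_ch_le (Finset.insert_subset_insert _ Finset.subset_union_right)

theorem Le.exists_mem_worker {X Y : Finset E} (h : M.Le X Y) {y : E} (hy : y ∈ Y) :
    ∃ x ∈ X, M.worker x = M.worker y := by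
  rcases h y hy with h | ⟨x, hx, hp⟩
  · exact ⟨y, h, rfl⟩
  · exact ⟨x, hx, hp.1⟩

/-- One inequality is cardinal monotonicity for `X ⊆ Y ∪ X`; the other injects `Y` into `X` by
workers, using unit quotas. -/
theorem Le.card_eq {X Y : Finset E} (h : M.Le X Y) (hX : M.Stable X) (hY : M.Stable Y) :
    X.card = Y.card := by
  apply le_antisymm
  · have := M.card_ch_le (Z := Y ∪ X) (Z' := X) Finset.subset_union_right
    rwa [h.ch_union hX hY, hX.ch_eq] at this
  · choose! g hg hw using fun y hy => h.exists_mem_worker (y := y) hy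
    refine Finset.card_le_card_of_injOn g hg fun y hy y' hy' hyy => ?_
    exact hY.unit y hy y' hy' (by rw [← hw y hy, ← hw y' hy', hyy])

/-- Comparable stable matchings cover the same workers. -/
theorem Le.exists_worse {X Y : Finset E} (h : M.Le X Y) (hX : M.Stable X) (hY : M.Stable Y)
    {x : E} (hx : x ∈ X) : ∃ y ∈ Y, x = y ∨ M.Pref x y := by
  classical
  have h1 : Y.image M.worker = X.image M.worker := by
    apply Finset.eq_of_subset_of_card_le
    · intro w hw
      obtain ⟨y, hy, rfl⟩ := Finset.mem_image.1 hw
      obtain ⟨x, hx, hxy⟩ := h.exists_mem_worker hy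
      exact Finset.mem_image.2 ⟨x, hx, hxy⟩
    · rw [Finset.card_image_of_injOn fun x hx y hy => hX.unit x hx y hy,
        Finset.card_image_of_injOn fun x hx y hy => hY.unit x hx y hy, h.card_eq hX hY]
  have h2 : M.worker x ∈ Y.image M.worker := h1 ▸ Finset.mem_image_of_mem _ hx
  obtain ⟨y, hy, hw⟩ := Finset.mem_image.1 h2
  refine ⟨y, hy, ?_⟩
  rcases h y hy with h3 | ⟨x', hx', hp⟩
  · exact Or.inl (hX.unit x hx y h3 hw.symm)
  · obtain rfl := hX.unit x hx x' hx' (hw.symm.trans hp.1.symm)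
    exact Or.inr hp

theorem Le.antisymm {X Y : Finset E} (h : M.Le X Y) (h' : M.Le Y X) (hX : M.Stable X)
    (hY : M.Stable Y) : X = Y := by
  have h1 := h.ch_union hX hY
  have h2 := h'.ch_union hY hX
  rw [Finset.union_comm, h2] at h1
  exact h1

/-! ### The least stable matching by deferred acceptance -/

section Xmin

variable (M) [Fintype E]

open scoped Classical in
/-- The offers made by the workers in the next round if the offers in `S` have been made. -/
noncomputable def offers : Set E →o Set E where
  toFun S := {e | ∀ e', M.Pref e' e → e' ∈ S ∧ e' ∉ M.ch S.toFinset}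
  monotone' := by
    intro S T hST e he e' hp
    obtain ⟨h1, h2⟩ := he e' hp
    refine ⟨hST h1, fun h => h2 ?_⟩
    exact M.mem_ch_of_subset (Set.toFinset_mono hST) h (Set.mem_toFinset.2 h1)

/-- `P` collects the offers made in worker-proposing deferred acceptance, and `X` those retained. An
edge never offered lies below a retained one, which gives stability. For minimality, the edges not
below a stable `Y` form a pre-fixed point of `offers`, so no worker ever offers an edge worse than
its edge in `Y`. -/
theorem exists_isXmin : ∃ X, M.IsXmin X := by
  classical
  set P := M.offers.lfp with hP
  have hfix : ∀ e, e ∈ P ↔ ∀ e', M.Pref e' e → e' ∈ P ∧ e' ∉ M.ch P.toFinset := by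
    intro e
    conv_lhs => rw [hP, ← M.offers.map_lfp]
    exact Iff.rfl
  set X := M.ch P.toFinset with hXdef
  have hXP : ∀ e ∈ X, e ∈ P := fun e he => Set.mem_toFinset.1 (M.ch_subset _ he)
  have hXsub : X ⊆ P.toFinset := M.ch_subset _
  have hbelow : ∀ e, e ∉ P → M.Below X e := by
    intro e
    induction e using M.pref_wellFounded.induction with
    | _ e ih =>
      intro he
      rw [hfix] at he
      push Not at he
      obtain ⟨e', hp, h⟩ := he
      by_cases he' : e' ∈ P
      · exact ⟨e', h he', hp⟩
      · exact (ih e' hp he').trans hp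
  have hstable : M.Stable X := by
    rw [stable_iff]
    refine ⟨M.ch_consistent hXsub subset_rfl, ?_, ?_⟩
    · intro x hx y hy hw
      by_contra hne
      rcases M.pref_or_pref hw hne with h | h
      · exact ((hfix y).1 (hXP y hy) x h).2 hx
      · exact ((hfix x).1 (hXP x hx) y h).2 hy
    · intro e he hch
      by_contra hB
      have heP : e ∈ P := by_contra fun h => hB (hbelow e h)
      refine he ?_
      rwa [M.ch_consistent (Z := P.toFinset) (Finset.insert_subset (Set.mem_toFinset.2 heP) hXsub)
        (Finset.subset_insert _ _)] at hch
  refine ⟨X, hstable, fun Y hY => (firmLE_iff_le hstable hY).2 ?_⟩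
  set Q : Set E := {e | ¬ M.Below Y e} with hQ
  have hYQ : Y ⊆ Q.toFinset := by
    intro y hy
    rw [Set.mem_toFinset]
    exact fun h => hY.unit.notMem_of_below h hy
  have hchQ : M.ch Q.toFinset = Y := by
    have h1 : M.ch Q.toFinset ⊆ Y := by
      intro e he
      by_contra heY
      refine Set.mem_toFinset.1 (M.ch_subset _ he) (hY.below heY ?_)
      exact M.mem_ch_of_subset (Finset.insert_subset (M.ch_subset _ he) hYQ) he
        (Finset.mem_insert_self _ _)
    rw [← M.ch_consistent hYQ h1, hY.ch_eq]
  have hPQ : P ⊆ Q := by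
    apply M.offers.lfp_le
    rintro e he ⟨y, hy, hp⟩
    refine (he y hp).2 ?_
    have hy' : y ∈ M.ch Q.toFinset := by rwa [hchQ]
    convert hy'
  intro y hy
  by_cases hyP : y ∈ P
  · refine Or.inl (M.mem_ch_of_subset (Set.toFinset_mono hPQ) ?_ (Set.mem_toFinset.2 hyP))
    rwa [hchQ]
  · exact Or.inr (hbelow y hyP)

end Xmin

end CombinedMarket

/-! ### Tandems and rotations -/

namespace CombinedMarket

variable {F W E : Type*} [DecidableEq E] (M : CombinedMarket F W E)

section Tandem

variable {M}

theorem WAdmissible.unique {X : Finset E} (hX : M.Unit X) {a a' : E} (h : M.WAdmissible X a)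
    (h' : M.WAdmissible X a') (hw : M.worker a = M.worker a') : a = a' := by
  by_contra hne
  rw [M.wAdmissible_iff hX] at h h'
  exact M.pref_irrefl _ ((h.2 a' h'.1.1 h'.1.2 hw.symm (Ne.symm hne)).trans
    (h'.2 a h.1.1 h.1.2 hw hne))

theorem Tandem.below {X : Finset E} (hX : M.Unit X) {a b : E} (h : M.Tandem X a b) :
    M.Below X a := ((M.wAdmissible_iff hX).1 h.1).1.1

theorem Tandem.notMem {X : Finset E} {a b : E} (h : M.Tandem X a b) : a ∉ X := h.1.1.2.1

theorem Tandem.mem {X : Finset E} {a b : E} (h : M.Tandem X a b) : b ∈ X :=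
  (M.mem_atFirm.1 h.2.1).1

theorem Tandem.ch_insert {X : Finset E} (hX : M.ch X = X) {a b : E} (h : M.Tandem X a b) :
    M.ch (insert a X) = insert a (X.erase b) := ((M.tandem_iff hX).1 h).2.2

theorem Tandem.notMem_ch {X : Finset E} (hX : M.ch X = X) {a b : E} (h : M.Tandem X a b) :
    b ∉ M.ch (insert a X) := by
  rw [h.ch_insert hX, Finset.mem_insert, Finset.mem_erase]
  rintro (rfl | h')
  · exact h.notMem h.mem
  · exact h'.1 rfl

theorem Tandem.unique {X : Finset E} (hX : M.ch X = X) {a b b' : E} (h : M.Tandem X a b)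
    (h' : M.Tandem X a b') : b = b' := by
  by_contra hne
  apply h.notMem_ch hX
  rw [h'.ch_insert hX]
  exact Finset.mem_insert_of_mem (Finset.mem_erase.2 ⟨hne, h.mem⟩)

end Tandem

/-- Induction around a cycle: `1` generates the cyclic group. -/
theorem forall_fin_of_add_one {n : ℕ} {P : Fin (n + 1) → Prop} (i₀ : Fin (n + 1)) (h₀ : P i₀)
    (h : ∀ i, P i → P (i + 1)) : ∀ j, P j := by
  have key : ∀ k : ℕ, P (i₀ + k • (1 : Fin (n + 1))) := by
    intro k
    induction k with
    | zero => simpa using h₀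
    | succ k ih =>
      rw [succ_nsmul, ← add_assoc]
      exact h _ ih
  intro j
  have := key (j - i₀).val
  open scoped Fin.NatCast Fin.CommRing in
  rw [nsmul_one, Fin.cast_val_eq_self] at this
  simpa using this

section Rotation

variable [Fintype E]

/-- Cycles of tandems survive the cleaning procedure. -/
theorem exists_isActiveGraph (X : Finset E) {A B : Finset E}
    (hA : ∀ a ∈ A, M.WAdmissible X a) (hB : ∀ b ∈ B, ∃ a ∈ A, M.Tandem X a b)
    (hAB : ∀ a ∈ A, ∃ b ∈ B, M.worker b = M.worker a) :
    ∃ Γ, M.IsActiveGraph X Γ ∧ A ⊆ Γ.toFirm ∧ B ⊆ Γ.toWorker := by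
  classical
  have key : ∀ (n : ℕ) (D : BipartiteDigraph E), D.toFirm.card ≤ n → A ⊆ D.toFirm →
      B ⊆ D.toWorker → ∃ Γ, Relation.ReflTransGen (M.CleaningStep X) D Γ ∧
        (∀ a, ¬ M.Deletable Γ a) ∧ A ⊆ Γ.toFirm ∧ B ⊆ Γ.toWorker := by
    intro n
    induction n with
    | zero =>
      intro D hD h1 h2
      refine ⟨D, .refl, fun a ha => ?_, h1, h2⟩
      rw [Nat.le_zero, Finset.card_eq_zero] at hD
      have := ha.1
      simp [hD] at this
    | succ n ih =>
      intro D hD h1 h2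
      by_cases hdel : ∃ a, M.Deletable D a
      · obtain ⟨a, ha⟩ := hdel
        -- An edge of `A` leaves a worker entered by an edge of `B`, so it is not deletable.
        have haA : a ∉ A := by
          intro h
          obtain ⟨b, hb, hw⟩ := hAB a h
          exact ha.2 b (h2 hb) hw
        obtain ⟨Γ, hΓ, h⟩ := ih (M.deleteArc X D a)
          (by
            have := Finset.card_erase_lt_of_mem ha.1
            simp only [deleteArc]
            omega)
          (fun x hx => Finset.mem_erase.2 ⟨fun h => haA (h ▸ hx), h1 hx⟩)
          (fun b hb => by
            simp only [deleteArc, Finset.mem_filter]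
            refine ⟨h2 hb, fun h => ?_⟩
            obtain ⟨a', ha', ht⟩ := hB b hb
            exact haA (h.2 a' (h1 ha') ht ▸ ha'))
        exact ⟨Γ, .head ⟨a, ha, rfl⟩ hΓ, h⟩
      · push Not at hdel
        exact ⟨D, .refl, hdel, h1, h2⟩
  obtain ⟨Γ, h1, h2, h3⟩ := key _ (M.admissibleGraph X) le_rfl
    (fun a ha => Finset.mem_filter.2 ⟨Finset.mem_univ _, hA a ha⟩)
    (fun b hb => Finset.mem_filter.2 ⟨Finset.mem_univ _, let ⟨a, _, h⟩ := hB b hb; ⟨a, h⟩⟩)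
  exact ⟨Γ, ⟨h1, h2⟩, h3⟩

/-- Cycles of tandems survive the cleaning, so the active graph can be forgotten from here on. -/
theorem isRotation_iff {X : Finset E} {L : SignedCycle E} :
    M.IsRotation X L ↔ ∃ (n : ℕ) (a b : Fin (n + 1) → E),
      Function.Injective a ∧ Function.Injective b ∧
      (∀ i, M.Tandem X (a i) (b i) ∧ M.worker (b i) = M.worker (a (i + 1))) ∧
      L.plus = Finset.univ.image a ∧ L.minus = Finset.univ.image b := by
  constructor
  · rintro ⟨Γ, -, n, a, b, ha, hb, h, h'⟩
    exact ⟨n, a, b, ha, hb, fun i => (h i).2.2, h'⟩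
  · rintro ⟨n, a, b, ha, hb, h, hp, hm⟩
    obtain ⟨Γ, hΓ, h1, h2⟩ := M.exists_isActiveGraph X (A := L.plus) (B := L.minus)
      (by
        intro x hx
        obtain ⟨i, -, rfl⟩ := Finset.mem_image.1 (hp ▸ hx)
        exact (h i).1.1)
      (by
        intro x hx
        obtain ⟨i, -, rfl⟩ := Finset.mem_image.1 (hm ▸ hx)
        exact ⟨a i, hp ▸ Finset.mem_image_of_mem _ (Finset.mem_univ _), (h i).1⟩)
      (by
        intro x hx
        obtain ⟨i, -, rfl⟩ := Finset.mem_image.1 (hp ▸ hx)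
        refine ⟨b (i - 1), hm ▸ Finset.mem_image_of_mem _ (Finset.mem_univ _), ?_⟩
        rw [(h (i - 1)).2, sub_add_cancel])
    refine ⟨Γ, hΓ, n, a, b, ha, hb, fun i => ⟨h1 ?_, h2 ?_, h i⟩, hp, hm⟩
    · exact hp ▸ Finset.mem_image_of_mem _ (Finset.mem_univ _)
    · exact hm ▸ Finset.mem_image_of_mem _ (Finset.mem_univ _)

variable {M}

namespace IsRotation

variable {X : Finset E} {L L' : SignedCycle E}

theorem exists_tandem_of_mem_plus (h : M.IsRotation X L) {a : E} (ha : a ∈ L.plus) :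
    ∃ b ∈ L.minus, M.Tandem X a b := by
  obtain ⟨n, a, b, -, -, h, hp, hm⟩ := M.isRotation_iff.1 h
  obtain ⟨i, -, rfl⟩ := Finset.mem_image.1 (hp ▸ ha)
  exact ⟨b i, hm ▸ Finset.mem_image_of_mem _ (Finset.mem_univ _), (h i).1⟩

theorem exists_tandem_of_mem_minus (h : M.IsRotation X L) {b : E} (hb : b ∈ L.minus) :
    ∃ a ∈ L.plus, M.Tandem X a b := by
  obtain ⟨n, a, b, -, -, h, hp, hm⟩ := M.isRotation_iff.1 h
  obtain ⟨i, -, rfl⟩ := Finset.mem_image.1 (hm ▸ hb)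
  exact ⟨a i, hp ▸ Finset.mem_image_of_mem _ (Finset.mem_univ _), (h i).1⟩

theorem exists_worker_of_mem_plus (h : M.IsRotation X L) {a : E} (ha : a ∈ L.plus) :
    ∃ b ∈ L.minus, M.worker b = M.worker a := by
  obtain ⟨n, a, b, -, -, h, hp, hm⟩ := M.isRotation_iff.1 h
  obtain ⟨i, -, rfl⟩ := Finset.mem_image.1 (hp ▸ ha)
  refine ⟨b (i - 1), hm ▸ Finset.mem_image_of_mem _ (Finset.mem_univ _), ?_⟩
  rw [(h (i - 1)).2, sub_add_cancel]

theorem exists_worker_of_mem_minus (h : M.IsRotation X L) {b : E} (hb : b ∈ L.minus) :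
    ∃ a ∈ L.plus, M.worker a = M.worker b := by
  obtain ⟨n, a, b, -, -, h, hp, hm⟩ := M.isRotation_iff.1 h
  obtain ⟨i, -, rfl⟩ := Finset.mem_image.1 (hm ▸ hb)
  exact ⟨a (i + 1), hp ▸ Finset.mem_image_of_mem _ (Finset.mem_univ _), (h i).2.symm⟩

theorem plus_nonempty (h : M.IsRotation X L) : L.plus.Nonempty := by
  obtain ⟨n, a, b, -, -, h, hp, hm⟩ := M.isRotation_iff.1 h
  exact ⟨a 0, hp ▸ Finset.mem_image_of_mem _ (Finset.mem_univ _)⟩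

theorem card_eq (h : M.IsRotation X L) : L.plus.card = L.minus.card := by
  obtain ⟨n, a, b, ha, hb, h, hp, hm⟩ := M.isRotation_iff.1 h
  rw [hp, hm, Finset.card_image_of_injective _ ha, Finset.card_image_of_injective _ hb]

theorem transfer {X' : Finset E} (h : M.IsRotation X L)
    (ht : ∀ a ∈ L.plus, ∀ b ∈ L.minus, M.Tandem X a b → M.Tandem X' a b) :
    M.IsRotation X' L := by
  obtain ⟨n, a, b, ha, hb, h, hp, hm⟩ := M.isRotation_iff.1 h
  refine M.isRotation_iff.2 ⟨n, a, b, ha, hb, fun i => ⟨ht _ ?_ _ ?_ (h i).1, (h i).2⟩, hp, hm⟩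
  · exact hp ▸ Finset.mem_image_of_mem _ (Finset.mem_univ _)
  · exact hm ▸ Finset.mem_image_of_mem _ (Finset.mem_univ _)

theorem minus_subset (h : M.IsRotation X L) : L.minus ⊆ X := fun _ hb =>
  let ⟨_, _, ht⟩ := h.exists_tandem_of_mem_minus hb
  ht.mem

theorem notMem_of_mem_plus (h : M.IsRotation X L) {a : E} (ha : a ∈ L.plus) : a ∉ X :=
  let ⟨_, _, ht⟩ := h.exists_tandem_of_mem_plus ha
  ht.notMem

theorem wAdmissible (h : M.IsRotation X L) {a : E} (ha : a ∈ L.plus) : M.WAdmissible X a :=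
  let ⟨_, _, ht⟩ := h.exists_tandem_of_mem_plus ha
  ht.1

theorem below_of_mem_plus (h : M.IsRotation X L) (hX : M.Unit X) {a : E} (ha : a ∈ L.plus) :
    M.Below X a :=
  ((M.wAdmissible_iff hX).1 (h.wAdmissible ha)).1.1

/-- A `W`-admissible edge determines its tandem, and the worker entered next determines the
following `W`-admissible edge, so rotations with a common edge continue alike. -/
theorem plus_subset_of_mem (h : M.IsRotation X L) (h' : M.IsRotation X L') (hX : M.Stable X)
    {a₀ : E} (ha : a₀ ∈ L.plus) (ha' : a₀ ∈ L'.plus) : L.plus ⊆ L'.plus := by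
  obtain ⟨n, a, b, -, -, h, hp, hm⟩ := M.isRotation_iff.1 h
  obtain ⟨i₀, -, rfl⟩ := Finset.mem_image.1 (hp ▸ ha)
  have key := forall_fin_of_add_one (P := fun i => a i ∈ L'.plus) i₀ ha' (by
    intro i hi
    obtain ⟨b', hb', ht'⟩ := h'.exists_tandem_of_mem_plus hi
    obtain rfl := (h i).1.unique hX.ch_eq ht'
    obtain ⟨a', ha', hw⟩ := h'.exists_worker_of_mem_minus hb'
    rwa [(h (i + 1)).1.1.unique hX.unit (h'.wAdmissible ha') ((h i).2.symm.trans hw.symm)])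
  rw [hp]
  intro x hx
  obtain ⟨i, -, rfl⟩ := Finset.mem_image.1 hx
  exact key i

theorem minus_subset_of_plus_subset (h : M.IsRotation X L) (h' : M.IsRotation X L')
    (hX : M.Stable X) (hs : L.plus ⊆ L'.plus) : L.minus ⊆ L'.minus := by
  intro b hb
  obtain ⟨a, ha, ht⟩ := h.exists_tandem_of_mem_minus hb
  obtain ⟨b', hb', ht'⟩ := h'.exists_tandem_of_mem_plus (hs ha)
  rwa [ht.unique hX.ch_eq ht']

/-- Rotations generated by the same stable matching that share a worker coincide. -/
theorem eq_of_worker_eq (h : M.IsRotation X L) (h' : M.IsRotation X L') (hX : M.Stable X)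
    {a a' : E} (ha : a ∈ L.plus) (ha' : a' ∈ L'.plus) (hw : M.worker a = M.worker a') :
    L = L' := by
  obtain rfl := (h.wAdmissible ha).unique hX.unit (h'.wAdmissible ha') hw
  have h1 := h.plus_subset_of_mem h' hX ha ha'
  have h2 := h'.plus_subset_of_mem h hX ha' ha
  exact SignedCycle.ext (h1.antisymm h2)
    ((h.minus_subset_of_plus_subset h' hX h1).antisymm (h'.minus_subset_of_plus_subset h hX h2))

end IsRotation

end Rotation

/-! ### Applying rotations -/

/-- The result of applying a rotation. -/
def apply (X : Finset E) (L : SignedCycle E) : Finset E := (X \ L.minus) ∪ L.plus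

theorem mem_apply {X : Finset E} {L : SignedCycle E} {e : E} :
    e ∈ apply X L ↔ e ∈ X ∧ e ∉ L.minus ∨ e ∈ L.plus := by
  simp [apply]

/-- If the edges of `A` are offered to the firms holding `X`, and each edge of `B` is pushed out by
one of them, where `A` and `B` have equal size, then exactly `B` is replaced. -/
theorem ch_union_of_card_eq {X A B : Finset E} (hX : M.ch X = X) (hBX : B ⊆ X)
    (hc : A.card = B.card)
    (hB : ∀ b ∈ B, ∃ a ∈ A, b ∉ M.ch (insert a X)) : M.ch (X ∪ A) = (X \ B) ∪ A := by
  apply Finset.eq_of_subset_of_card_le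
  · intro e he
    have h1 := Finset.mem_union.1 (M.ch_subset _ he)
    rw [Finset.mem_union, Finset.mem_sdiff]
    refine h1.imp_left fun h => ⟨h, fun hb => ?_⟩
    obtain ⟨a, ha, h2⟩ := hB e hb
    exact h2 (M.mem_ch_of_subset (Finset.insert_subset (Finset.mem_union_right _ ha)
      Finset.subset_union_left) he (Finset.mem_insert_of_mem h))
  -- Cardinal monotonicity: the choice from the larger set has at least `X.card` elements, so
  -- nothing else is rejected.
  · calc ((X \ B) ∪ A).card ≤ (X \ B).card + A.card := Finset.card_union_le _ _
      _ = X.card := by rw [hc, Finset.card_sdiff_add_card_eq_card hBX]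
      _ = (M.ch X).card := by rw [hX]
      _ ≤ _ := M.card_ch_le Finset.subset_union_left

theorem apply_subset {X : Finset E} {L : SignedCycle E} : apply X L ⊆ X ∪ L.plus :=
  Finset.union_subset_union_left Finset.sdiff_subset

section Apply

variable [Fintype E] {M}

namespace IsRotation

variable {X : Finset E} {L L' : SignedCycle E}

theorem ch_union_plus (h : M.IsRotation X L) (hX : M.Stable X) :
    M.ch (X ∪ L.plus) = apply X L := by
  refine M.ch_union_of_card_eq hX.ch_eq h.minus_subset h.card_eq fun b hb => ?_
  obtain ⟨a, ha, ht⟩ := h.exists_tandem_of_mem_minus hb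
  exact ⟨a, ha, ht.notMem_ch hX.ch_eq⟩

theorem unit_apply (h : M.IsRotation X L) (hX : M.Stable X) : M.Unit (apply X L) := by
  have key : ∀ x ∈ X, x ∉ L.minus → ∀ y ∈ L.plus, M.worker x ≠ M.worker y := by
    intro x hx hxm y hy hw
    obtain ⟨b, hb, hbw⟩ := h.exists_worker_of_mem_plus hy
    exact hxm (hX.unit x hx b (h.minus_subset hb) (hw.trans hbw.symm) ▸ hb)
  intro x hx y hy hw
  rcases mem_apply.1 hx with ⟨hx, hxm⟩ | hx <;> rcases mem_apply.1 hy with ⟨hy, hym⟩ | hy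
  · exact hX.unit x hx y hy hw
  · exact absurd hw (key x hx hxm y hy)
  · exact absurd hw.symm (key y hy hym x hx)
  · exact (h.wAdmissible hx).unique hX.unit (h.wAdmissible hy) hw

theorem le_apply (h : M.IsRotation X L) (hX : M.Stable X) : M.Le X (apply X L) := by
  intro y hy
  rcases mem_apply.1 hy with ⟨hy, -⟩ | hy
  · exact Or.inl hy
  · exact Or.inr (h.below_of_mem_plus hX.unit hy)

theorem stable_apply (h : M.IsRotation X L) (hX : M.Stable X) : M.Stable (apply X L) := by
  have hch := h.ch_union_plus hX
  have hsub : apply X L ⊆ X ∪ L.plus := apply_subset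
  refine M.stable_iff.2 ⟨?_, h.unit_apply hX, fun e he hche => ?_⟩
  · rw [M.ch_consistent hsub hch.le, hch]
  -- The choice from `X ∪ L.plus` is `apply X L`, so by consistency a rejection of `e` there would
  -- be a rejection at `apply X L`. Substitutability then carries the interest in `e` down to `X`.
  have heT : e ∈ M.ch (insert e (X ∪ L.plus)) := by
    by_contra hcon
    rw [M.ch_consistent (Z := insert e (X ∪ L.plus)) (Finset.insert_subset_insert _ hsub)] at hche
    · exact hcon hche
    · rw [M.ch_insert_of_notMem hcon, hch]
      exact Finset.subset_insert _ _
  have heX : e ∉ X := by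
    intro heX
    rw [Finset.insert_eq_of_mem (Finset.mem_union_left _ heX), hch] at heT
    exact he heT
  have hcand : e ∈ M.ch (insert e X) := M.mem_ch_of_subset
    (Finset.insert_subset_insert _ Finset.subset_union_left) heT (Finset.mem_insert_self _ _)
  obtain ⟨x, hx, hp⟩ := hX.below heX hcand
  -- If the worker's edge is replaced, the new edge is its best candidate under `X`, and `e` is
  -- another candidate.
  by_cases hxm : x ∈ L.minus
  · obtain ⟨a, ha, hw⟩ := h.exists_worker_of_mem_minus hxm
    refine ⟨a, mem_apply.2 (Or.inr ha), ?_⟩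
    refine ((M.wAdmissible_iff hX.unit).1 (h.wAdmissible ha)).2 e ⟨x, hx, hp⟩ hcand
      (hp.1.symm.trans hw.symm) ?_
    rintro rfl
    exact he (mem_apply.2 (Or.inr ha))
  · exact ⟨x, mem_apply.2 (Or.inl ⟨hx, hxm⟩), hp⟩

theorem disjoint_plus (h : M.IsRotation X L) (h' : M.IsRotation X L') (hX : M.Stable X)
    (hne : L ≠ L') : ∀ a ∈ L.plus, a ∉ L'.plus :=
  fun _ ha ha' => hne (h.eq_of_worker_eq h' hX ha ha' rfl)

theorem disjoint_minus (h : M.IsRotation X L) (h' : M.IsRotation X L') (hX : M.Stable X)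
    (hne : L ≠ L') : ∀ b ∈ L.minus, b ∉ L'.minus := by
  intro b hb hb'
  obtain ⟨a, ha, hw⟩ := h.exists_worker_of_mem_minus hb
  obtain ⟨a', ha', hw'⟩ := h'.exists_worker_of_mem_minus hb'
  exact hne (h.eq_of_worker_eq h' hX ha ha' (hw.trans hw'.symm))

theorem apply_comm (h : M.IsRotation X L) (h' : M.IsRotation X L') :
    apply (apply X L) L' = apply (apply X L') L := by
  ext e
  have h1 : e ∈ L.plus → e ∉ L'.minus :=
    fun h1 h2 => h.notMem_of_mem_plus h1 (h'.minus_subset h2)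
  have h2 : e ∈ L'.plus → e ∉ L.minus :=
    fun h1 h2 => h'.notMem_of_mem_plus h1 (h.minus_subset h2)
  simp only [mem_apply]
  tauto

/-- Distinct rotations generated by the same stable matching can be applied in any order. -/
theorem isRotation_apply (h : M.IsRotation X L) (h' : M.IsRotation X L') (hX : M.Stable X)
    (hne : L ≠ L') : M.IsRotation (apply X L) L' := by
  have hS := h.stable_apply hX
  refine h'.transfer fun a ha b hb ht => ?_
  have haL : a ∉ L.plus := fun h1 => h.disjoint_plus h' hX hne a h1 ha
  have hbL : b ∉ L.minus := fun h1 => h.disjoint_minus h' hX hne b h1 hb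
  have hworker : ∀ y ∈ L.plus, M.worker y ≠ M.worker a :=
    fun y hy hw => hne (h.eq_of_worker_eq h' hX hy ha hw)
  have hbS : b ∈ apply X L := mem_apply.2 (Or.inl ⟨ht.mem, hbL⟩)
  have haS : a ∉ apply X L := fun h1 => by
    rcases mem_apply.1 h1 with h1 | h1
    · exact ht.notMem h1.1
    · exact haL h1
  have hbp : b ∉ L.plus := fun h1 => h.notMem_of_mem_plus h1 ht.mem
  -- The tandem `(a, b)` is carried out together with all tandems of `L`, so that the counting
  -- argument applies to all of them at once.
  have hch : M.ch (X ∪ insert a L.plus) = insert a ((apply X L).erase b) := by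
    rw [M.ch_union_of_card_eq (B := insert b L.minus) hX.ch_eq
      (Finset.insert_subset ht.mem h.minus_subset)]
    · ext x
      simp only [Finset.mem_union, Finset.mem_sdiff, Finset.mem_insert, Finset.mem_erase, mem_apply]
      have : x ∈ L.plus → x ≠ b := fun h1 h2 => hbp (h2 ▸ h1)
      tauto
    · rw [Finset.card_insert_of_notMem haL, Finset.card_insert_of_notMem hbL, h.card_eq]
    · intro c hc
      rcases Finset.mem_insert.1 hc with rfl | hc
      · exact ⟨a, Finset.mem_insert_self _ _, ht.notMem_ch hX.ch_eq⟩
      · obtain ⟨a', ha', ht'⟩ := h.exists_tandem_of_mem_minus hc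
        exact ⟨a', Finset.mem_insert_of_mem ha', ht'.notMem_ch hX.ch_eq⟩
  have hch' : M.ch (insert a (apply X L)) = insert a ((apply X L).erase b) := by
    rw [M.ch_consistent (Z := X ∪ insert a L.plus) _ _, hch]
    · rw [Finset.union_insert]
      exact Finset.insert_subset_insert _ apply_subset
    · rw [hch]
      exact Finset.insert_subset_insert _ (Finset.erase_subset _ _)
  refine (M.tandem_iff hS.ch_eq).2 ⟨(M.wAdmissible_iff hS.unit).2 ⟨⟨?_, ?_⟩, ?_⟩, hbS, hch'⟩
  · obtain ⟨x, hx, hp⟩ := ht.below hX.unit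
    refine ⟨x, mem_apply.2 (Or.inl ⟨hx, fun hxm => ?_⟩), hp⟩
    obtain ⟨y, hy, hw⟩ := h.exists_worker_of_mem_minus hxm
    exact hworker y hy (hw.trans hp.1)
  · rw [hch']
    exact Finset.mem_insert_self _ _
  · intro e hB hche hw hea
    refine ((M.wAdmissible_iff hX.unit).1 ht.1).2 e ((h.le_apply hX).below hB) ?_ hw hea
    exact (h.le_apply hX).mem_ch_insert hX hS hche (Finset.mem_insert_self _ _)

/-- An edge of `L.plus` below `Y` would be below `apply X L`, which contains it. So a rotation, once
passed, is never generated again. -/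
theorem not_isRotation_of_le {Y : Finset E} (hL : M.IsRotation X L) (hX : M.Stable X)
    (h : M.Le (apply X L) Y) (hY : M.Stable Y) : ¬ M.IsRotation Y L := by
  intro h'
  obtain ⟨a, ha⟩ := hL.plus_nonempty
  exact (hL.unit_apply hX).notMem_of_below (h.below (h'.below_of_mem_plus hY.unit ha))
    (mem_apply.2 (Or.inr ha))

theorem apply_le_apply {Y : Finset E} (hY : M.IsRotation Y L)
    (hYs : M.Stable Y) (h : M.Le X Y) : M.Le (apply X L) (apply Y L) := by
  intro y hy
  rcases mem_apply.1 hy with ⟨hy, hym⟩ | hy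
  · rcases h y hy with h1 | ⟨x, hx, hp⟩
    · exact Or.inl (mem_apply.2 (Or.inl ⟨h1, hym⟩))
    · refine Or.inr ⟨x, mem_apply.2 (Or.inl ⟨hx, fun hxm => ?_⟩), hp⟩
      obtain rfl := hYs.unit x (hY.minus_subset hxm) y hy hp.1
      exact M.pref_irrefl _ hp
  · exact Or.inl (mem_apply.2 (Or.inr hy))

end IsRotation

/-- A stable matching strictly below `Y` generates a rotation that does not lead beyond `Y`. -/
theorem Le.exists_isRotation {X Y : Finset E} (h : M.Le X Y) (hX : M.Stable X) (hY : M.Stable Y)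
    (hne : X ≠ Y) : ∃ L, M.IsRotation X L ∧ M.Le (apply X L) Y := by
  classical
  -- For a worker whose edge changes, the edge `y` in `Y` is a candidate, so a best candidate `a`
  -- exists and is no worse than `y`. The edge `b` displaced by `a` is not in `Y`. Thus `x ↦ b` maps
  -- `X \ Y` to itself, and a cycle of this map is the rotation.
  have step : ∀ x : {x // x ∈ X \ Y}, ∃ (a : E) (b : {x // x ∈ X \ Y}),
      M.worker a = M.worker x ∧ M.Tandem X a b ∧ ¬ M.Below Y a := by
    rintro ⟨x, hx⟩
    rw [Finset.mem_sdiff] at hx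
    obtain ⟨y, hy, hxy⟩ := h.exists_worse hX hY hx.1
    have hp : M.Pref x y := hxy.resolve_left fun h1 => hx.2 (h1 ▸ hy)
    have hyc : M.Below X y ∧ y ∈ M.ch (insert y X) :=
      ⟨⟨x, hx.1, hp⟩, h.mem_ch_insert hX hY
        (by rwa [Finset.insert_eq_of_mem hy, hY.ch_eq]) (Finset.mem_insert_self _ _)⟩
    obtain ⟨a, ⟨haw, haB, hac⟩, hmin⟩ := M.pref_wellFounded.has_min
      {e | M.worker e = M.worker x ∧ M.Below X e ∧ e ∈ M.ch (insert e X)} ⟨y, hp.1.symm, hyc⟩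
    have hadm : M.WAdmissible X a := (M.wAdmissible_iff hX.unit).2 ⟨⟨haB, hac⟩,
      fun e h1 h2 hw hea => (M.pref_or_pref hw.symm (Ne.symm hea)).resolve_right
        (hmin e ⟨hw.trans haw, h1, h2⟩)⟩
    have haX : a ∉ X := hX.unit.notMem_of_below haB
    have haY : ¬ M.Below Y a := by
      rintro ⟨y', hy', hp'⟩
      obtain rfl := hY.unit y hy y' hy' ((hp.1.symm.trans haw.symm).trans hp'.1.symm)
      exact hmin y ⟨hp.1.symm, hyc⟩ hp'
    have hchY : M.ch (insert a Y) = Y := by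
      by_cases haY' : a ∈ Y
      · rw [Finset.insert_eq_of_mem haY', hY.ch_eq]
      · rw [M.ch_insert_of_notMem fun h1 => haY (hY.below haY' h1), hY.ch_eq]
    -- The firms cannot keep everything: even at `Y` they hold only `Y.card = X.card` edges after
    -- the offer of `a`.
    have hlt : (M.ch (insert a X)).card < (insert a X).card := by
      have h1 := h.card_ch_insert_le hX hY a
      rw [hchY, ← h.card_eq hX hY] at h1
      rw [Finset.card_insert_of_notMem haX]
      omega
    obtain ⟨b, hb, hbc⟩ := Finset.exists_mem_notMem_of_card_lt_card hlt
    have hba : b ≠ a := fun h1 => hbc (h1 ▸ hac)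
    have hbX : b ∈ X := (Finset.mem_insert.1 hb).resolve_left hba
    have hbY : b ∉ Y := fun h1 => hbc (h.mem_ch_insert hX hY (by rwa [hchY]) hb)
    refine ⟨a, ⟨b, Finset.mem_sdiff.2 ⟨hbX, hbY⟩⟩, haw, ?_, haY⟩
    refine (M.tandem_iff hX.ch_eq).2 ⟨hadm, hbX, ?_⟩
    rw [← Finset.erase_insert_of_ne hba.symm]
    apply Finset.eq_of_subset_of_card_le
    · exact Finset.subset_erase.2 ⟨M.ch_subset _, hbc⟩
    · rw [Finset.card_erase_of_mem hb, Finset.card_insert_of_notMem haX, Nat.add_sub_cancel]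
      conv_lhs => rw [← hX.ch_eq]
      exact M.card_ch_le (Finset.subset_insert _ _)
  choose α φ hα ht hαY using step
  have hne' : (X \ Y).Nonempty := by
    rw [Finset.sdiff_nonempty]
    exact fun h1 => hne (Finset.eq_of_subset_of_card_le h1 (h.card_eq hX hY).ge)
  obtain ⟨x₀, hx₀⟩ := hne'
  obtain ⟨m, m', hmm, heq⟩ := Finite.exists_ne_map_eq_of_infinite
    fun n : ℕ => φ^[n] ⟨x₀, hx₀⟩
  wlog hlt : m < m' generalizing m m'
  · exact this m' m hmm.symm heq.symm (by omega)
  set x := φ^[m] ⟨x₀, hx₀⟩ with hx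
  have hper : x ∈ Function.periodicPts φ := by
    refine Function.mk_mem_periodicPts (n := m' - m) (by omega) ?_
    rw [Function.IsPeriodicPt, Function.IsFixedPt, hx, ← Function.iterate_add_apply,
      Nat.sub_add_cancel hlt.le]
    exact heq.symm
  have hpos := Function.minimalPeriod_pos_of_mem_periodicPts hper
  obtain ⟨n, hn⟩ : ∃ n, Function.minimalPeriod φ x = n + 1 :=
    ⟨Function.minimalPeriod φ x - 1, by omega⟩
  have hinj : Function.Injective fun i : Fin (n + 1) => φ^[i.val] x := by
    intro i j hij
    exact Fin.ext (Function.iterate_injOn_Iio_minimalPeriod (f := φ) (x := x)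
      (Set.mem_Iio.2 (by omega)) (Set.mem_Iio.2 (by omega)) hij)
  -- The index wraps around at the minimal period `n + 1`.
  have hsucc : ∀ i : Fin (n + 1), φ^[(i + 1).val] x = φ (φ^[i.val] x) := by
    intro i
    rw [← Function.iterate_succ_apply' φ, ← Function.iterate_mod_minimalPeriod_eq (n := i.val.succ),
      hn, Fin.val_add, Fin.val_one', Nat.add_mod_mod]
  have hwX : ∀ u v : {x // x ∈ X \ Y}, M.worker u = M.worker v → u = v := fun u v huv =>
    Subtype.ext (hX.unit _ (Finset.mem_sdiff.1 u.2).1 _ (Finset.mem_sdiff.1 v.2).1 huv)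
  set a : Fin (n + 1) → E := fun i => α (φ^[i.val] x) with ha
  set b : Fin (n + 1) → E := fun i => φ (φ^[i.val] x) with hb
  have hrot : M.IsRotation X ⟨Finset.univ.image a, Finset.univ.image b⟩ := by
    refine M.isRotation_iff.2 ⟨n, a, b, ?_, ?_, fun i => ⟨ht _, ?_⟩, rfl, rfl⟩
    · intro i j hij
      exact hinj (hwX _ _ (by rw [← hα, ← hα]; exact congrArg M.worker hij))
    · intro i j hij
      have h1 : φ^[(i + 1).val] x = φ^[(j + 1).val] x := by
        rw [hsucc, hsucc]
        exact Subtype.ext hij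
      exact add_right_cancel (hinj h1)
    · simp only [ha, hb]
      rw [hα, hsucc]
  refine ⟨_, hrot, fun y hy => ?_⟩
  rcases h y hy with h1 | ⟨z, hz, hp⟩
  · refine Or.inl (mem_apply.2 (Or.inl ⟨h1, fun h2 => ?_⟩))
    obtain ⟨i, -, rfl⟩ := Finset.mem_image.1 h2
    exact (Finset.mem_sdiff.1 (φ (φ^[i.val] x)).2).2 hy
  · by_cases hzm : z ∈ Finset.univ.image b
    · obtain ⟨a', ha', hw⟩ := hrot.exists_worker_of_mem_minus hzm
      obtain ⟨i, -, rfl⟩ := Finset.mem_image.1 ha'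
      have hwy : M.worker (a i) = M.worker y := hw.trans hp.1
      by_cases hya : a i = y
      · exact Or.inl (mem_apply.2 (Or.inr (hya ▸ ha')))
      · refine Or.inr ⟨a i, mem_apply.2 (Or.inr ha'), ?_⟩
        exact (M.pref_or_pref hwy hya).resolve_right fun h2 => hαY _ ⟨y, hy, h2⟩
    · exact Or.inr ⟨z, mem_apply.2 (Or.inl ⟨hz, hzm⟩), hp⟩

/-- If `Q` can be applied at `V` and at `Z`, and `R` both after `Q` and at `Z`, then `R` can be
applied at `V` already. -/
theorem IsRotation.of_apply {V Z : Finset E} {Q R : SignedCycle E} (hV : M.Stable V)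
    (hZ : M.Stable Z) (hVZ : M.Le V Z) (hQ : M.IsRotation V Q) (hQZ : M.IsRotation Z Q)
    (hR : M.IsRotation (apply V Q) R) (hRZ : M.IsRotation Z R) : M.IsRotation V R := by
  set U := apply V Q with hU
  have hUs : M.Stable U := hQ.stable_apply hV
  have hVU : M.Le V U := hQ.le_apply hV
  have hVsub : ∀ c ∈ V, c ∉ U → c ∈ Z := by
    intro c hc hcU
    refine hQZ.minus_subset ?_
    by_contra hcm
    exact hcU (mem_apply.2 (Or.inl ⟨hc, hcm⟩))
  have hRV : ∀ c ∈ R.minus, c ∈ V := by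
    intro c hc
    rcases mem_apply.1 (hR.minus_subset hc) with h | h
    · exact h.1
    · exact absurd (hRZ.minus_subset hc) (hQZ.notMem_of_mem_plus h)
  -- Edges of `V` missing from `U` lie in `Q.minus`, hence in `Z`. Both `U` and `Z` are above `V`,
  -- so whether an edge is kept can be checked in one of them and carried down.
  have hkeep : ∀ e, ∀ c ∈ V, (c ∈ U → c ∈ M.ch (insert e U)) →
      (c ∉ U → c ∈ M.ch (insert e Z)) → c ∈ M.ch (insert e V) := by
    intro e c hc h1 h2
    by_cases hcU : c ∈ U
    · exact hVU.mem_ch_insert hV hUs (h1 hcU) (Finset.mem_insert_of_mem hc)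
    · exact hVZ.mem_ch_insert hV hZ (h2 hcU) (Finset.mem_insert_of_mem hc)
  refine hR.transfer fun a ha b hb ht => ?_
  obtain ⟨b', hb', htZ⟩ := hRZ.exists_tandem_of_mem_plus ha
  have hbV : b ∈ V := hRV b hb
  obtain ⟨x, hxm, hxw⟩ := hR.exists_worker_of_mem_plus ha
  have hxV : x ∈ V := hRV x hxm
  have hxU : x ∈ U := hR.minus_subset hxm
  have hxZ : x ∈ Z := hRZ.minus_subset hxm
  have hadmU := (M.wAdmissible_iff hUs.unit).1 ht.1
  have hadmZ := (M.wAdmissible_iff hZ.unit).1 htZ.1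
  have haV : M.Below V a := hVU.below hadmU.1.1
  have haVc : a ∈ M.ch (insert a V) :=
    hVU.mem_ch_insert hV hUs hadmU.1.2 (Finset.mem_insert_self _ _)
  have haVn : a ∉ V := hV.unit.notMem_of_below haV
  refine (M.tandem_iff hV.ch_eq).2 ⟨(M.wAdmissible_iff hV.unit).2 ⟨⟨haV, haVc⟩, ?_⟩, hbV, ?_⟩
  · intro e heB hec hew hea
    by_contra hcon
    have hp : M.Pref e a := (M.pref_or_pref hew hea).resolve_right hcon
    have hxe : M.Pref x e := by
      obtain ⟨x', hx', hp'⟩ := heB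
      rwa [hV.unit x hxV x' hx' ((hxw.trans hew.symm).trans hp'.1.symm)]
    have heU : e ∉ M.ch (insert e U) := fun h1 =>
      hcon (hadmU.2 e ⟨x, hxU, hxe⟩ h1 hew hea)
    have heZ : e ∉ M.ch (insert e Z) := fun h1 =>
      hcon (hadmZ.2 e ⟨x, hxZ, hxe⟩ h1 hew hea)
    have hchU : M.ch (insert e U) = U := by rw [M.ch_insert_of_notMem heU, hUs.ch_eq]
    have hchZ : M.ch (insert e Z) = Z := by rw [M.ch_insert_of_notMem heZ, hZ.ch_eq]
    -- A better candidate `e` would be rejected at `U` and at `Z`, where all held edges are kept. At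
    -- `V` it would be accepted with all of `V` kept, one edge more than the bound from `U` allows.
    have hsub : insert e V ⊆ M.ch (insert e V) := by
      refine Finset.insert_subset hec fun c hc => hkeep e c hc ?_ ?_
      · rw [hchU]
        exact id
      · rw [hchZ]
        exact hVsub c hc
    have h1 := Finset.card_le_card hsub
    have h2 := hVU.card_ch_insert_le hV hUs e
    rw [hchU, ← hVU.card_eq hV hUs] at h2
    rw [Finset.card_insert_of_notMem (hV.unit.notMem_of_below heB)] at h1
    omega
  · symm
    -- All of `V` except `b` is kept: edges in `U` by the tandem `(a, b)` there, the others by the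
    -- tandem `(a, b')` at `Z`, as `b' ∈ U`. The cardinality bound from `U` excludes `b`.
    apply Finset.eq_of_subset_of_card_le
    · refine Finset.insert_subset haVc fun c hc => ?_
      obtain ⟨hcb, hc⟩ := Finset.mem_erase.1 hc
      refine hkeep a c hc (fun hcU => ?_) (fun hcU => ?_)
      · rw [ht.ch_insert hUs.ch_eq]
        exact Finset.mem_insert_of_mem (Finset.mem_erase.2 ⟨hcb, hcU⟩)
      · rw [htZ.ch_insert hZ.ch_eq]
        refine Finset.mem_insert_of_mem (Finset.mem_erase.2 ⟨?_, hVsub c hc hcU⟩)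
        rintro rfl
        exact hcU (hR.minus_subset hb')
    · refine (hVU.card_ch_insert_le hV hUs a).trans ?_
      rw [ht.ch_insert hUs.ch_eq, Finset.card_insert_of_notMem
        (fun h1 => ht.notMem (Finset.mem_erase.1 h1).2), Finset.card_erase_of_mem ht.mem,
        Finset.card_insert_of_notMem (fun h1 => haVn (Finset.mem_erase.1 h1).2),
        Finset.card_erase_of_mem hbV, hVU.card_eq hV hUs]

end Apply

end CombinedMarket

/-! ### Order of occurrence in lists -/

theorem List.pair_sublist_append_cons {α : Type*} {l₁ l₂ : List α} {a b : α} (ha : a ∈ l₁) :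
    List.Sublist [a, b] (l₁ ++ b :: l₂) :=
  (List.singleton_sublist.2 ha).append (List.singleton_sublist.2 List.mem_cons_self)

theorem List.mem_left_of_pair_sublist {α : Type*} {l₁ l₂ : List α} (hl : (l₁ ++ l₂).Nodup)
    {a b : α} (h : List.Sublist [a, b] (l₁ ++ l₂)) (hb : b ∈ l₁) : a ∈ l₁ := by
  have hb' : b ∉ l₂ := fun h' => (List.nodup_append.1 hl).2.2 b hb b h' rfl
  obtain ⟨s, t, hst, hs, ht⟩ := List.sublist_append_iff.1 h
  match s with
  | [] =>
    obtain rfl : [a, b] = t := hst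
    exact absurd (ht.subset (by simp)) hb'
  | x :: s =>
    obtain ⟨rfl, -⟩ := List.cons.inj hst
    exact hs.subset List.mem_cons_self

theorem List.pair_sublist_trans {α : Type*} {l : List α} (hl : l.Nodup) {a b c : α}
    (h : List.Sublist [a, b] l) (h' : List.Sublist [b, c] l) : List.Sublist [a, c] l := by
  obtain ⟨r, r', rfl, hb, hc⟩ := List.cons_sublist_iff.1 h'
  have ha := List.mem_left_of_pair_sublist hl h hb
  exact (List.singleton_sublist.2 ha).append hc

namespace CombinedMarket

variable {F W E : Type*} [DecidableEq E] {M : CombinedMarket F W E}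

theorem IsXmin.le {X Y : Finset E} (hX : M.IsXmin X) (hY : M.Stable Y) : M.Le X Y :=
  (firmLE_iff_le hX.1 hY).1 (hX.2 Y hY)

theorem IsXmax.le {X Y : Finset E} (hX : M.IsXmax X) (hY : M.Stable Y) : M.Le Y X :=
  (firmLE_iff_le hY hX.1).1 (hX.2 Y hY)

/-! ### Routes and the greatest stable matching -/

section Route

variable [Fintype E] {X Y Z : Finset E} {l l' : List (SignedCycle E)} {L L' : SignedCycle E}

namespace Route

theorem stable_left (h : M.Route X l Y) : M.Stable X := by
  cases h <;> assumption

theorem stable_right (h : M.Route X l Y) : M.Stable Y := by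
  induction h <;> assumption

theorem le (h : M.Route X l Y) : M.Le X Y := by
  induction h with
  | nil X _ => exact Le.refl X
  | cons X Y L l hX hL _ ih => exact (hL.le_apply hX).trans ih

theorem append (h : M.Route X l Y) (h' : M.Route Y l' Z) : M.Route X (l ++ l') Z := by
  induction h with
  | nil X _ => exact h'
  | cons X Y L l hX hL _ ih => exact .cons X Z L _ hX hL (ih h')

theorem exists_of_append (h : M.Route X (l ++ l') Z) :
    ∃ Y, M.Route X l Y ∧ M.Route Y l' Z := by
  induction l generalizing X with
  | nil => exact ⟨X, .nil X h.stable_left, h⟩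
  | cons L l ih =>
    cases h with
    | cons X _ L _ hX hL h =>
      obtain ⟨Y, h1, h2⟩ := ih h
      exact ⟨Y, .cons X Y L l hX hL h1, h2⟩

theorem of_isRotation (hX : M.Stable X) (hL : M.IsRotation X L) :
    M.Route X [L] (apply X L) :=
  .cons X _ L [] hX hL (.nil _ (hL.stable_apply hX))

theorem below_of_mem (h : M.Route X l Y) (hL : L ∈ l) {e : E} (he : e ∈ L.plus) : M.Below X e := by
  induction h with
  | nil => simp at hL
  | cons X Y L' l hX hL' _ ih =>
    rcases List.mem_cons.1 hL with rfl | hL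
    · exact hL'.below_of_mem_plus hX.unit he
    · exact (hL'.le_apply hX).below (ih hL)

/-- After `L` is applied its positive edges are held, whereas those of all later rotations lie below
that matching. -/
theorem nodup (h : M.Route X l Y) : l.Nodup := by
  induction h with
  | nil => exact List.nodup_nil
  | cons X Y L l hX hL hl ih =>
    refine List.nodup_cons.2 ⟨fun hmem => ?_, ih⟩
    obtain ⟨a, ha⟩ := hL.plus_nonempty
    exact (hL.unit_apply hX).notMem_of_below (below_of_mem hl hmem ha) (mem_apply.2 (Or.inr ha))

end Route

open scoped Classical in
/-- The number of edges below `X`; it decreases along routes. -/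
noncomputable def rank (M : CombinedMarket F W E) (X : Finset E) : ℕ :=
  (Finset.univ.filter (M.Below X)).card

theorem IsRotation.rank_lt (h : M.IsRotation X L) (hX : M.Stable X) :
    M.rank (apply X L) < M.rank X := by
  classical
  apply Finset.card_lt_card
  rw [Finset.ssubset_iff_of_subset]
  · obtain ⟨a, ha⟩ := h.plus_nonempty
    refine ⟨a, Finset.mem_filter.2 ⟨Finset.mem_univ _, h.below_of_mem_plus hX.unit ha⟩, fun h1 => ?_⟩
    exact (h.unit_apply hX).notMem_of_below (Finset.mem_filter.1 h1).2 (mem_apply.2 (Or.inr ha))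
  · exact Finset.monotone_filter_right _ fun e _ he => (h.le_apply hX).below he

theorem Le.exists_route (h : M.Le X Y) (hX : M.Stable X) (hY : M.Stable Y) :
    ∃ l, M.Route X l Y := by
  induction hn : M.rank X using Nat.strong_induction_on generalizing X with
  | _ n ih =>
    by_cases hne : X = Y
    · exact ⟨[], hne ▸ .nil X hX⟩
    · obtain ⟨L, hL, hle⟩ := h.exists_isRotation hX hY hne
      obtain ⟨l, hl⟩ := ih _ (hn ▸ hL.rank_lt hX) hle (hL.stable_apply hX) rfl
      exact ⟨L :: l, .cons X Y L l hX hL hl⟩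

/-- A rotation stays available along a route until it is applied. -/
theorem Route.mem_or_isRotation (h : M.Route X l Y) (hL : M.IsRotation X L) :
    (L ∈ l ∧ M.Le (apply X L) Y) ∨ M.IsRotation Y L := by
  induction h with
  | nil => exact Or.inr hL
  | cons X Y L' l hX hL' hl ih =>
    by_cases hne : L' = L
    · subst hne
      exact Or.inl ⟨List.mem_cons_self, hl.le⟩
    · rcases ih (hL'.isRotation_apply hL hX hne) with ⟨h1, h2⟩ | h1
      · refine Or.inl ⟨List.mem_cons_of_mem _ h1, Le.trans ?_ h2⟩
        have := (hL.isRotation_apply hL' hX (Ne.symm hne)).le_apply (hL.stable_apply hX)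
        rwa [hL.apply_comm hL'] at this
      · exact Or.inr h1

/-- Any two routes with the same ends apply the same rotations. -/
theorem Route.perm (h : M.Route X l Y) (h' : M.Route X l' Y) : l.Perm l' := by
  induction hn : l.length using Nat.strong_induction_on generalizing X l l' with
  | _ n ih =>
  subst hn
  cases h with
  | nil _ hX =>
    cases h' with
    | nil => rfl
    | cons _ _ L' l' _ hL' h' =>
      exact absurd hL' (hL'.not_isRotation_of_le hX h'.le hX)
  | cons _ _ L l hX hL hl =>
    cases h' with
    | nil => exact absurd hL (hL.not_isRotation_of_le hX hl.le hX)
    | cons _ _ L' l' _ hL' hl' =>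
      by_cases hne : L = L'
      · subst hne
        exact (ih l.length (by simp) hl hl' rfl).cons L
      · have hLL' := hL.isRotation_apply hL' hX hne
        have hL'L := hL'.isRotation_apply hL hX (Ne.symm hne)
        -- Both orders of `L` and `L'` lead to the same matching. If it is below `Y`, both tails are
        -- compared with one route `m` from there; otherwise `L'` would still be available at `Y`,
        -- although the second route has passed it.
        rcases Route.mem_or_isRotation hl hLL' with ⟨-, hle⟩ | h1
        · obtain ⟨m, hm⟩ := hle.exists_route (hLL'.stable_apply (hL.stable_apply hX))
            hl.stable_right
          have h1 := ih l.length (by simp) hl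
            (.cons _ _ L' m (hL.stable_apply hX) hLL' hm) rfl
          change M.Route (apply (apply X L) L') m Y at hm
          rw [hL.apply_comm hL'] at hm
          have h2 := ih (L :: m).length (by simp [h1.length_eq])
            (.cons _ _ L m (hL'.stable_apply hX) hL'L hm) hl' rfl
          exact (h1.cons L).trans ((List.Perm.swap L' L m).trans (h2.cons L'))
        · exact absurd h1 (hL'.not_isRotation_of_le hX hl'.le hl.stable_right)

/-- A route can be shifted upwards, omitting some of its rotations. -/
theorem Route.exists_shift (h : M.Route X l Y) (hZ : M.Stable Z) (hXZ : M.Le X Z) :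
    ∃ l' T, M.Route Z l' T ∧ M.Le Y T ∧ l' ⊆ l := by
  induction h generalizing Z with
  | nil X => exact ⟨[], Z, .nil Z hZ, hXZ, List.Subset.refl _⟩
  | cons X Y L l hX hL hl ih =>
    -- Between `X` and `Z` the rotation `L` is either applied, and then omitted from the shifted
    -- route, or still available at `Z`.
    obtain ⟨m, hm⟩ := hXZ.exists_route hX hZ
    rcases hm.mem_or_isRotation hL with ⟨-, hle⟩ | hLZ
    · obtain ⟨l', T, h1, h2, h3⟩ := ih hZ hle
      exact ⟨l', T, h1, h2, List.subset_cons_of_subset _ h3⟩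
    · obtain ⟨l', T, h1, h2, h3⟩ := ih (hLZ.stable_apply hZ) (hLZ.apply_le_apply hZ hXZ)
      exact ⟨L :: l', T, .cons _ _ L l' hZ hLZ h1, h2, List.cons_subset_cons _ h3⟩

-- A stable `T` of least rank generates no rotation. Given `Y`, let `U` have least rank among the
-- stable matchings below both. A rotation from `U` towards `Y` cannot survive up to `T`, so it is
-- applied on the way there and its result is again below both. Hence `U = Y`.
variable (M) in
theorem exists_isXmax : ∃ X, M.IsXmax X := by
  obtain ⟨X₀, hX₀, hmin⟩ := M.exists_isXmin
  obtain ⟨T, hT, hTm⟩ := (measure M.rank).wf.has_min {X | M.Stable X} ⟨X₀, hX₀⟩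
  have hTr : ∀ L, ¬ M.IsRotation T L := fun L hL =>
    hTm _ (hL.stable_apply hT) (hL.rank_lt hT)
  refine ⟨T, hT, fun Y hY => (firmLE_iff_le hY hT).2 ?_⟩
  obtain ⟨U, ⟨hU, hUY, hUT⟩, hUm⟩ := (measure M.rank).wf.has_min
    {X | M.Stable X ∧ M.Le X Y ∧ M.Le X T}
    ⟨X₀, hX₀, (firmLE_iff_le hX₀ hY).1 (hmin Y hY), (firmLE_iff_le hX₀ hT).1 (hmin T hT)⟩
  by_cases hne : U = Y
  · exact hne ▸ hUT
  · obtain ⟨L, hL, hle⟩ := hUY.exists_isRotation hU hY hne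
    obtain ⟨m, hm⟩ := hUT.exists_route hU hT
    rcases hm.mem_or_isRotation hL with ⟨-, h1⟩ | h1
    · exact absurd (hL.rank_lt hU) (hUm _ ⟨hL.stable_apply hU, hle, h1⟩)
    · exact absurd h1 (hTr L)

theorem fullRoute_iff {X₀ X₁ : Finset E} (h₀ : M.IsXmin X₀) (h₁ : M.IsXmax X₁) :
    M.FullRoute l ↔ M.Route X₀ l X₁ := by
  constructor
  · rintro ⟨Y₀, Y₁, h₀', h₁', h⟩
    rwa [(h₀.le h₀'.1).antisymm (h₀'.le h₀.1) h₀.1 h₀'.1,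
      (h₁'.le h₁.1).antisymm (h₁.le h₁'.1) h₁.1 h₁'.1]
  · exact fun h => ⟨X₀, X₁, h₀, h₁, h⟩

theorem FullRoute.perm (h : M.FullRoute l) (h' : M.FullRoute l') : l.Perm l' := by
  obtain ⟨X₀, X₁, h₀, h₁, hl⟩ := h
  exact hl.perm ((fullRoute_iff h₀ h₁).1 h')

theorem FullRoute.nodup (h : M.FullRoute l) : l.Nodup :=
  let ⟨_, _, _, _, hl⟩ := h
  Route.nodup hl

theorem FullRoute.mem (h : M.FullRoute l) (R : M.Rotation) : R.1 ∈ l :=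
  let ⟨_, hl', hR⟩ := R.2
  (h.perm hl').mem_iff.2 hR

variable (M) in
theorem exists_fullRoute : ∃ l, M.FullRoute l := by
  obtain ⟨X₀, h₀⟩ := M.exists_isXmin
  obtain ⟨X₁, h₁⟩ := M.exists_isXmax
  obtain ⟨l, hl⟩ := (h₀.le h₁.1).exists_route h₀.1 h₁.1
  exact ⟨l, X₀, X₁, h₀, h₁, hl⟩

theorem Route.exists_fullRoute (hX : M.IsXmin X) (h : M.Route X l Y) :
    ∃ l', M.FullRoute (l ++ l') := by
  obtain ⟨X₁, h₁⟩ := M.exists_isXmax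
  obtain ⟨l', hl'⟩ := (h₁.le h.stable_right).exists_route h.stable_right h₁.1
  exact ⟨l', X, X₁, hX, h₁, h.append hl'⟩

/-! ### The rotational poset and its ideals -/

variable (M) in
theorem isStrictOrder_precedes : IsStrictOrder M.Rotation M.Precedes where
  irrefl R h := by
    obtain ⟨l, hl, -⟩ := R.2
    simpa using (h l hl).nodup hl.nodup
  trans _ _ _ h h' l hl := List.pair_sublist_trans hl.nodup (h l hl) (h' l hl)

/-- The route is an initial segment of a full route, where predecessors come earlier. -/
theorem Route.isRotationIdeal (hX : M.IsXmin X) (h : M.Route X l Y) :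
    M.IsRotationIdeal {R | R.1 ∈ l} := by
  intro R R' hRR' hR'
  obtain ⟨l', hl'⟩ := h.exists_fullRoute hX
  exact List.mem_left_of_pair_sublist hl'.nodup (hRR' _ hl') hR'

/-- If some full route applies `R` before `Q`, then `R` need not wait for `Q`. -/
theorem Route.isRotation_of_apply {X₀ V X₁ : Finset E} {Q R : SignedCycle E}
    {p m₁ m₂ : List (SignedCycle E)} (hV : M.Route X₀ p V) (hQ : M.IsRotation V Q)
    (hR : M.IsRotation (apply V Q) R) (hm : M.Route X₀ (m₁ ++ R :: m₂) X₁) (hQm : Q ∉ m₁) :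
    M.IsRotation V R := by
  have hVs := hV.stable_right
  have hRp : R ∉ p := by
    have h1 := ((hV.append (.of_isRotation hVs hQ)).append
      (.of_isRotation (hQ.stable_apply hVs) hR)).nodup
    intro h2
    exact (List.nodup_append.1 h1).2.2 R (List.mem_append_left _ h2) R (by simp) rfl
  have hRm : R ∉ m₁ := fun h => (List.nodup_append.1 hm.nodup).2.2 R h R (by simp) rfl
  obtain ⟨T, hT, hT'⟩ := hm.exists_of_append
  have hRT : M.IsRotation T R := by
    cases hT' with
    | cons _ _ _ _ _ h _ => exact h
  -- `Z` lies above `V` and `T`. `Q` survives from `V` to `Z` since it is not in `m₁`, and `R`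
  -- survives from `T` since it is neither in `p` nor in `m₁`.
  obtain ⟨l', Z, hVZ, hTZ, hl'⟩ := hT.exists_shift hVs hV.le
  have hQZ : M.IsRotation Z Q :=
    (hVZ.mem_or_isRotation hQ).resolve_left fun h => hQm (hl' h.1)
  obtain ⟨n, hn⟩ := hTZ.exists_route hT.stable_right hVZ.stable_right
  have hRZ : M.IsRotation Z R := by
    refine (hn.mem_or_isRotation hRT).resolve_left fun h => ?_
    have h1 := ((hT.append hn).perm (hV.append hVZ)).mem_iff.1 (List.mem_append_right _ h.1)
    rcases List.mem_append.1 h1 with h1 | h1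
    · exact hRp h1
    · exact hRm (hl' h1)
  exact IsRotation.of_apply hVs hVZ.stable_right hVZ.le hQ hQZ hR hRZ

/-- The rotations not in an ideal can be postponed. -/
theorem Route.isRotation_of_isRotationIdeal {X₀ V X₁ : Finset E} (h₀ : M.IsXmin X₀)
    (h₁ : M.IsXmax X₁) {I : Set M.Rotation} (hI : M.IsRotationIdeal I) {R : M.Rotation}
    (hR : R ∈ I) {p l₁ l₂ : List (SignedCycle E)} (hl₁ : ∀ Q : M.Rotation, Q.1 ∈ l₁ → Q ∉ I)
    (hV : M.Route X₀ p V) (h : M.Route V (l₁ ++ R.1 :: l₂) X₁) : M.IsRotation V R.1 := by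
  induction l₁ generalizing V p with
  | nil =>
    cases h with
    | cons _ _ _ _ _ h _ => exact h
  | cons Q l₁ ih =>
    have hfull : M.FullRoute (p ++ (Q :: l₁ ++ R.1 :: l₂)) := ⟨X₀, X₁, h₀, h₁, hV.append h⟩
    cases h with
    | cons _ _ _ _ hVs hQ h =>
      have hRQ := ih (fun Q' hQ' => hl₁ Q' (List.mem_cons_of_mem _ hQ'))
        (hV.append (.of_isRotation hVs hQ)) h
      -- The ideal contains `R` but not `Q`, so some full route does not apply `Q` before `R`.
      have hnot : ¬ M.Precedes ⟨Q, _, hfull, by simp⟩ R := fun hp =>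
        hl₁ ⟨Q, _, hfull, by simp⟩ List.mem_cons_self (hI _ _ hp hR)
      simp only [Precedes, not_forall] at hnot
      obtain ⟨m, hm, hsub⟩ := hnot
      obtain ⟨m₁, m₂, rfl⟩ := List.append_of_mem (hm.mem R)
      exact hV.isRotation_of_apply hQ hRQ ((fullRoute_iff h₀ h₁).1 hm) fun hQm =>
        hsub (List.pair_sublist_append_cons hQm)

/-- Every ideal consists of the rotations of a route from the minimal stable matching. -/
theorem IsRotationIdeal.exists_route {X₀ : Finset E} (h₀ : M.IsXmin X₀) {I : Set M.Rotation}
    (hI : M.IsRotationIdeal I) :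
    ∃ l X, M.Route X₀ l X ∧ ∀ R : M.Rotation, R ∈ I ↔ R.1 ∈ l := by
  classical
  obtain ⟨X₁, h₁⟩ := M.exists_isXmax
  -- `p` applies only rotations of `I`, and `s` completes it to a full route. Each round moves the
  -- first rotation of `I` in `s` to the end of `p`; the new tail is shorter by one because routes
  -- with the same ends are permutations of each other.
  have key : ∀ (n : ℕ) (p s : List (SignedCycle E)) (V : Finset E), s.length = n →
      M.Route X₀ p V → M.Route V s X₁ → (∀ R : M.Rotation, R.1 ∈ p → R ∈ I) →
      ∃ l X, M.Route X₀ l X ∧ ∀ R : M.Rotation, R ∈ I ↔ R.1 ∈ l := by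
    intro n
    induction n with
    | zero =>
      intro p s V hs hp hVs hpI
      obtain rfl := List.length_eq_zero_iff.1 hs
      refine ⟨p, V, hp, fun R => ⟨fun _ => ?_, hpI R⟩⟩
      simpa using FullRoute.mem ⟨X₀, X₁, h₀, h₁, hp.append hVs⟩ R
    | succ n ih =>
      intro p s V hs hp hVs hpI
      by_cases hex : ∃ R : M.Rotation, R ∈ I ∧ R.1 ∈ s
      · obtain ⟨R, l₁, l₂, rfl, hR, hl₁⟩ : ∃ (R : M.Rotation) (l₁ l₂ : List (SignedCycle E)),
            s = l₁ ++ R.1 :: l₂ ∧ R ∈ I ∧ ∀ Q : M.Rotation, Q.1 ∈ l₁ → Q ∉ I := by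
          clear hs hVs
          induction s with
          | nil => simp at hex
          | cons L s ihs =>
            by_cases hL : ∃ R : M.Rotation, R ∈ I ∧ R.1 = L
            · obtain ⟨R, hR, rfl⟩ := hL
              exact ⟨R, [], s, rfl, hR, by simp⟩
            · obtain ⟨R, l₁, l₂, rfl, hR, h⟩ := ihs (by
                obtain ⟨R, hR, hRs⟩ := hex
                exact ⟨R, hR, (List.mem_cons.1 hRs).resolve_left fun h => hL ⟨R, hR, h⟩⟩)
              refine ⟨R, L :: l₁, l₂, rfl, hR, fun Q hQ hQI => ?_⟩
              rcases List.mem_cons.1 hQ with h1 | h1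
              · exact hL ⟨Q, hQI, h1⟩
              · exact h Q h1 hQI
        have hrot := Route.isRotation_of_isRotationIdeal h₀ h₁ hI hR hl₁ hp hVs
        have hV := hp.stable_right
        obtain ⟨t, ht⟩ := (h₁.le (hrot.stable_apply hV)).exists_route (hrot.stable_apply hV) h₁.1
        have hlen := (hVs.perm (.cons _ _ _ t hV hrot ht)).length_eq
        refine ih (p ++ [R.1]) t _ ?_ (hp.append (.of_isRotation hV hrot)) ht fun Q hQ => ?_
        · rw [hs] at hlen
          simpa using hlen.symm
        · rcases List.mem_append.1 hQ with hQ | hQ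
          · exact hpI Q hQ
          · rwa [Subtype.ext (List.mem_singleton.1 hQ)]
      · refine ⟨p, V, hp, fun R => ⟨fun hR => ?_, hpI R⟩⟩
        have := FullRoute.mem ⟨X₀, X₁, h₀, h₁, hp.append hVs⟩ R
        exact (List.mem_append.1 this).resolve_right fun h => hex ⟨R, hR, h⟩
  obtain ⟨s, hs⟩ := (h₀.le h₁.1).exists_route h₀.1 h₁.1
  exact key _ [] s X₀ rfl (.nil _ h₀.1) hs (by simp)

end Route

end CombinedMarket

/-! ### Order polytopes and affine dimension -/

/-- The order polytope of a finite relation is the convex hull of its ideals. -/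
theorem convexHull_indicator_ideals {α : Type*} [Finite α] (r : α → α → Prop) :
    convexHull ℝ {u : α → ℝ | ∃ I : Set α, (∀ a b, r a b → b ∈ I → a ∈ I) ∧ u = I.indicator 1} =
      {u | (∀ a, 0 ≤ u a ∧ u a ≤ 1) ∧ ∀ a b, r a b → u b ≤ u a} := by
  classical
  have := Fintype.ofFinite α
  apply Set.Subset.antisymm
  · refine convexHull_min ?_ ?_
    · rintro _ ⟨I, hI, rfl⟩
      refine ⟨fun a => ?_, fun a b hab => ?_⟩
      · by_cases h : a ∈ I <;> simp [h]
      · by_cases hb : b ∈ I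
        · simp [hb, hI a b hab hb]
        · by_cases ha : a ∈ I <;> simp [ha, hb]
    · rintro u ⟨hu, hu'⟩ v ⟨hv, hv'⟩ s t hs ht hst
      refine ⟨fun a => ?_, fun a b hab => ?_⟩
      · simp only [Pi.add_apply, Pi.smul_apply, smul_eq_mul]
        have h1 := hu a
        have h2 := hv a
        constructor
        · have := mul_nonneg hs h1.1
          have := mul_nonneg ht h2.1
          linarith
        · have := mul_le_mul_of_nonneg_left h1.2 hs
          have := mul_le_mul_of_nonneg_left h2.2 ht
          linarith
      · simp only [Pi.add_apply, Pi.smul_apply, smul_eq_mul]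
        exact add_le_add (mul_le_mul_of_nonneg_left (hu' a b hab) hs)
          (mul_le_mul_of_nonneg_left (hv' a b hab) ht)
  · rintro u ⟨hu, hu'⟩
    -- For `t` uniform in `(0, 1]`, the superlevel set of `u` at `t` is an ideal, and its mean
    -- indicator is `u`. The indicators are finitely many, so their hull is closed and contains the
    -- mean.
    set μ : MeasureTheory.Measure ℝ := MeasureTheory.volume.restrict (Set.Ioc 0 1) with hμ
    have hprob : MeasureTheory.IsProbabilityMeasure μ := ⟨by simp [hμ]⟩
    set f : ℝ → α → ℝ := fun t => Set.indicator {a | t ≤ u a} 1 with hf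
    have hfa : ∀ a, (fun t => f t a) = (Set.Iic (u a)).indicator 1 := by
      intro a
      ext t
      simp [hf, Set.indicator_apply]
    have hint : ∀ a, MeasureTheory.Integrable (fun t => f t a) μ := by
      intro a
      rw [hfa]
      exact (MeasureTheory.integrable_const (1 : ℝ)).indicator measurableSet_Iic
    have hval : ∫ t, f t ∂μ = u := by
      ext a
      rw [MeasureTheory.eval_integral hint, hfa, MeasureTheory.integral_indicator_one
        measurableSet_Iic, hμ, MeasureTheory.measureReal_restrict_apply measurableSet_Iic]
      have : Set.Iic (u a) ∩ Set.Ioc 0 1 = Set.Ioc 0 (u a) := by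
        ext t
        simp only [Set.mem_inter_iff, Set.mem_Iic, Set.mem_Ioc]
        have := (hu a).2
        constructor
        · rintro ⟨h1, h2, -⟩
          exact ⟨h2, h1⟩
        · rintro ⟨h1, h2⟩
          exact ⟨h2, h1, h2.trans this⟩
      rw [this, Real.volume_real_Ioc_of_le (hu a).1, sub_zero]
    rw [← hval]
    refine Convex.integral_mem (convex_convexHull ℝ _) (Set.Finite.isClosed_convexHull ℝ ?_)
      (Filter.Eventually.of_forall fun t => subset_convexHull ℝ _ ?_)
      (MeasureTheory.Integrable.of_eval hint)
    · refine (Set.finite_range fun I : Set α => I.indicator (1 : α → ℝ)).subset ?_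
      rintro _ ⟨I, -, rfl⟩
      exact ⟨I, rfl⟩
    · exact ⟨{a | t ≤ u a}, fun a b hab hb => le_trans hb (hu' a b hab), rfl⟩

theorem affineDim_image_of_injective {V V' : Type*} [AddCommGroup V] [Module ℝ V]
    [AddCommGroup V'] [Module ℝ V'] (f : V →ᵃ[ℝ] V') (hf : Function.Injective f) (P : Set V) :
    affineDim (f '' P) = affineDim P := by
  rw [affineDim, affineDim, ← AffineSubspace.map_span, AffineSubspace.map_direction]
  exact (Submodule.equivMapOfInjective f.linear
    ((AffineMap.linear_injective_iff f).2 hf) _).finrank_eq.symm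

/-! ### Rotation vectors and the affine map onto the matching polytope -/

namespace CombinedMarket

variable {F W E : Type*} [DecidableEq E] {M : CombinedMarket F W E}

/-- The vector `β^L`, which is `1` on `L.plus`, `-1` on `L.minus` and `0` elsewhere. -/
def signVector (L : SignedCycle E) : E → ℝ :=
  fun e => if e ∈ L.plus then 1 else if e ∈ L.minus then -1 else 0

variable [Fintype E] {X Y : Finset E} {l : List (SignedCycle E)} {L : SignedCycle E}

theorem IsRotation.edgeVector_apply (h : M.IsRotation X L) :
    edgeVector (apply X L) = edgeVector X + signVector L := by
  ext e
  have h1 : e ∈ L.plus → e ∉ X := h.notMem_of_mem_plus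
  have h2 : e ∈ L.minus → e ∈ X := fun h' => h.minus_subset h'
  simp only [edgeVector, signVector, Pi.add_apply, mem_apply]
  by_cases hp : e ∈ L.plus <;> by_cases hm : e ∈ L.minus <;> by_cases hx : e ∈ X <;>
    simp_all

theorem Route.edgeVector_eq (h : M.Route X l Y) :
    edgeVector Y = edgeVector X + (l.map signVector).sum := by
  induction h with
  | nil => simp
  | cons X Y L l hX hL _ ih =>
    rw [ih]
    change edgeVector (apply X L) + _ = _
    rw [hL.edgeVector_apply, List.map_cons, List.sum_cons, add_assoc]

/-- The vectors of the rotations of a route are linearly independent, already when restricted to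
the edges below its starting point. -/
theorem Route.eq_zero_of_sum_eq_zero (h : M.Route X l Y) (c : SignedCycle E → ℝ)
    (hc : ∀ e, M.Below X e → (l.map fun L => c L * signVector L e).sum = 0) :
    ∀ L ∈ l, c L = 0 := by
  induction h with
  | nil => simp
  | cons X Y L l hX hL hl ih =>
    -- Edges below `apply X L` lie in neither part of `L`, so there the relation involves the tail
    -- only. Once the tail coefficients vanish, an edge of `L.plus` detects that of `L`.
    have hzero : ∀ L' ∈ l, c L' = 0 := by
      apply ih
      intro e he
      have heX := (hL.le_apply hX).below he
      have hne : e ∉ apply X L := (hL.unit_apply hX).notMem_of_below he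
      have hsign : signVector L e = 0 := by
        rw [signVector, if_neg fun h => hne (mem_apply.2 (Or.inr h)),
          if_neg fun h => hX.unit.notMem_of_below heX (hL.minus_subset h)]
      simpa [hsign] using hc e heX
    intro L' hL'
    rcases List.mem_cons.1 hL' with rfl | h'
    · obtain ⟨a, ha⟩ := hL.plus_nonempty
      have h1 := hc a (hL.below_of_mem_plus hX.unit ha)
      have h2 : (l.map fun L => c L * signVector L a).sum = 0 := by
        apply List.sum_eq_zero
        intro x hx
        obtain ⟨L, hL, rfl⟩ := List.mem_map.1 hx
        rw [hzero L hL, zero_mul]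
      rw [List.map_cons, List.sum_cons, h2] at h1
      simpa [signVector, ha] using h1
    · exact hzero L' h'

open scoped Classical in
theorem sum_rotation_eq {A : Type*} [AddCommMonoid A] (hl : l.Nodup)
    (hR : ∀ L ∈ l, ∃ R : M.Rotation, R.1 = L) (g : SignedCycle E → A) :
    ∑ R : M.Rotation, (if R.1 ∈ l then g R.1 else 0) = (l.map g).sum := by
  rw [← Finset.sum_filter, ← List.sum_toFinset g hl]
  refine Finset.sum_bij (fun R _ => R.1) ?_ ?_ ?_ ?_
  · intro R h
    simpa using h
  · intro R _ R' _ h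
    exact Subtype.ext h
  · intro L hL
    obtain ⟨R, rfl⟩ := hR L (by simpa using hL)
    exact ⟨R, by simpa using hL, rfl⟩
  · simp

theorem FullRoute.exists_rotation (h : M.FullRoute l) (hL : L ∈ l) : ∃ R : M.Rotation, R.1 = L :=
  ⟨⟨L, l, h, hL⟩, rfl⟩

theorem Route.exists_rotation (hX : M.IsXmin X) (h : M.Route X l Y) (hL : L ∈ l) :
    ∃ R : M.Rotation, R.1 = L := by
  obtain ⟨l', hl'⟩ := h.exists_fullRoute hX
  exact hl'.exists_rotation (List.mem_append_left _ hL)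

theorem rotationMatrix_mulVec (u : M.Rotation → ℝ) (e : E) :
    M.rotationMatrix.mulVec u e = ∑ R : M.Rotation, u R * signVector R.1 e := by
  simp only [Matrix.mulVec, dotProduct]
  exact Finset.sum_congr rfl fun R _ => mul_comm _ _

-- A full route lists all of ℛ, so the columns are the vectors of a single route.
variable (M) in
theorem rotationMatrix_mulVec_injective : Function.Injective M.rotationMatrix.mulVecLin := by
  classical
  rw [injective_iff_map_eq_zero]
  intro u hu
  obtain ⟨l, hl⟩ := M.exists_fullRoute
  obtain ⟨X₀, X₁, h₀, h₁, hroute⟩ := id hl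
  set c : SignedCycle E → ℝ := fun L => if h : ∃ l, M.FullRoute l ∧ L ∈ l then u ⟨L, h⟩ else 0
    with hcdef
  have hc : ∀ R : M.Rotation, c R.1 = u R := fun R => dif_pos R.2
  have key := hroute.eq_zero_of_sum_eq_zero c fun e _ => by
    rw [← sum_rotation_eq hl.nodup (fun L hL => hl.exists_rotation hL)
      (fun L => c L * signVector L e)]
    have h1 := congrFun hu e
    rw [Matrix.mulVecLin_apply, rotationMatrix_mulVec] at h1
    simpa [hl.mem, hc] using h1
  ext R
  rw [← hc]
  exact key _ (hl.mem R)

theorem gamma_apply (u : M.Rotation → ℝ) :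
    M.gamma X u = edgeVector X + M.rotationMatrix.mulVec u := by
  simp [gamma]

variable (M) in
theorem gamma_injective (X : Finset E) : Function.Injective (M.gamma X) := by
  intro u v h
  rw [gamma_apply, gamma_apply] at h
  exact M.rotationMatrix_mulVec_injective (add_left_cancel h)

theorem Route.gamma_indicator (hX : M.IsXmin X) (h : M.Route X l Y) {I : Set M.Rotation}
    (hI : ∀ R : M.Rotation, R ∈ I ↔ R.1 ∈ l) :
    M.gamma X (I.indicator 1) = edgeVector Y := by
  classical
  rw [gamma_apply, h.edgeVector_eq]
  congr 1
  ext e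
  rw [rotationMatrix_mulVec, ← sum_rotation_eq h.nodup fun L hL => h.exists_rotation hX hL,
    Finset.sum_apply]
  refine Finset.sum_congr rfl fun R _ => ?_
  by_cases hR : R ∈ I
  · simp [hR, (hI R).1 hR]
  · simp [hR, (hI R).not.1 hR]

/-- Affine maps commute with convex hulls, so it suffices to match generators: ideals and stable
matchings both correspond to routes from `X`. -/
theorem IsXmin.gamma_image (hX : M.IsXmin X) :
    M.gamma X '' M.idealPolytope = M.matchingPolytope := by
  rw [idealPolytope, matchingPolytope, AffineMap.image_convexHull]
  congr 1
  ext x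
  constructor
  · rintro ⟨_, ⟨I, hI, rfl⟩, rfl⟩
    obtain ⟨l, Y, h, hl⟩ := hI.exists_route hX
    exact ⟨Y, h.stable_right, h.gamma_indicator hX hl⟩
  · rintro ⟨Y, hY, rfl⟩
    obtain ⟨l, h⟩ := (hX.le hY).exists_route hX.1 hY
    exact ⟨_, ⟨_, h.isRotationIdeal hX, rfl⟩, h.gamma_indicator hX fun R => Iff.rfl⟩

variable (M)

theorem affineDim_idealPolytope : affineDim M.idealPolytope = Fintype.card M.Rotation := by
  classical
  have := M.isStrictOrder_precedes
  have hmem : ∀ I : Set M.Rotation, M.IsRotationIdeal I →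
      (I.indicator 1 : M.Rotation → ℝ) ∈ affineSpan ℝ M.idealPolytope := fun I hI =>
    subset_affineSpan ℝ _ (subset_convexHull ℝ _ ⟨I, hI, rfl⟩)
  have htop : (affineSpan ℝ M.idealPolytope).direction = ⊤ := by
    rw [eq_top_iff, ← (Pi.basisFun ℝ M.Rotation).span_eq, Submodule.span_le]
    rintro _ ⟨R, rfl⟩
    -- The predecessors of `R`, with and without `R` itself, form ideals whose indicators differ by
    -- the basis vector at `R`.
    have h1 := hmem {R' | M.Precedes R' R} fun Q Q' h h' => this.trans _ _ _ h h'
    have h2 := hmem {R' | M.Precedes R' R ∨ R' = R} fun Q Q' h h' => by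
      rcases h' with h' | rfl
      · exact Or.inl (this.trans _ _ _ h h')
      · exact Or.inl h
    have h3 := AffineSubspace.vsub_mem_direction h2 h1
    rw [vsub_eq_sub] at h3
    refine (congrArg (· ∈ (affineSpan ℝ M.idealPolytope).direction) ?_).mpr h3
    ext R'
    by_cases hRR' : R' = R
    · subst hRR'
      simp [this.irrefl]
    · by_cases hp : M.Precedes R' R <;> simp [hRR', hp]
  rw [affineDim, htop, finrank_top, Module.finrank_fintype_fun_eq_card]

end CombinedMarket

theorem corollary6p1 {F W E : Type*} [DecidableEq E] [Fintype E] (M : CombinedMarket F W E) :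
    IsStrictOrder M.Rotation M.Precedes ∧
    M.rotationMatrix.rank = Fintype.card M.Rotation ∧
    affineDim M.matchingPolytope = Fintype.card M.Rotation ∧
    affineDim M.idealPolytope = Fintype.card M.Rotation ∧
    M.idealPolytope = M.orderPolytope ∧
    ∃ Xmin, M.IsXmin Xmin ∧
      Function.Injective (M.gamma Xmin) ∧
      M.gamma Xmin '' M.idealPolytope = M.matchingPolytope := by
  obtain ⟨X, hX⟩ := M.exists_isXmin
  refine ⟨M.isStrictOrder_precedes, ?_, ?_, M.affineDim_idealPolytope,
    convexHull_indicator_ideals M.Precedes, X, hX, M.gamma_injective X, hX.gamma_image⟩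
  · rw [Matrix.rank, LinearMap.finrank_range_of_inj M.rotationMatrix_mulVec_injective,
      Module.finrank_fintype_fun_eq_card]
  · rw [← hX.gamma_image, affineDim_image_of_injective _ (M.gamma_injective X),
      M.affineDim_idealPolytope]
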